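/- Let $\mathscr{A}$ be a unital complex $*$-algebra and $\mathscr{B}\subseteq\mathscr{A}$ a unital $*$-subalgebra whose C*-enveloping algebra $B$ exists (the completion of $\mathscr{B}$ for the largest C*-seminorm), with canonical $*$-homomorphism $\iota:\mathscr{B}\to B$. Let $\varepsilon:\mathscr{A}\to\mathbb{C}$ be a character (a unital $*$-homomorphism) and $\pi:\mathscr{A}\to\mathcal{B}(\mathcal{H})$ a unital $*$-representation by bounded operators on a Hilbert space such that $$\pi(b)-\varepsilon(b)\in\mathcal{L}^1(\mathcal{H})\quad\text{(trace class)}\qquad\text{for all } b\in\mathscr{B}.$$ Let $\mathrm{Vect}_{\mathscr{A}}(\mathscr{B})$ be the collection of $\mathscr{B}$-bimodules $\mathscr{E}$ that are finitely generated and projective as right $\mathscr{B}$-modules and that trivialize over $\mathscr{A}$: for some $r\ge 0$ there is an isomorphism $\mathscr{E}\otimes_{\mathscr{B}}\mathscr{A}\cong\mathscr{A}^r$ of $\mathscr{B}$-$\mathscr{A}$-bimodules, where $\mathscr{A}$ acts on $\mathscr{A}^r$ by right multiplication and $\mathscr{B}$ by left multiplication, entrywise. If $\mathscr{E}$ is finitely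 generated and projective as a right $\mathscr{B}$-module and $p\in M_N(\mathscr{B})$ is an idempotent with $\mathscr{E}\cong p\,\mathscr{B}^N$ as right $\mathscr{B}$-modules, write $$\mathrm{ch}_0(\mathscr{E})=\varepsilon(\mathrm{Tr}\,p),\qquad \mathrm{ch}_1(\mathscr{E})=\mathrm{Tr}_{\mathcal{H}}\big(\pi(\mathrm{Tr}\,p)-\varepsilon(\mathrm{Tr}\,p)\big),$$ and let $[\mathscr{E}]\in K_0(B)$ be the class of the idempotent $\iota(p)\in M_N(B)$. Write $1\in K_0(B)$ for the class of the unit. Assume that $K_0(B)\cong\mathbb{Z}^2$ as abelian groups and that $\mathscr{E}\in\mathrm{Vect}_{\mathscr{A}}(\mathscr{B})$ has $\mathrm{ch}_1(\mathscr{E})=\pm1$. Then $(1,[\mathscr{E}])$ is a basis of the $\mathbb{Z}$-module $K_0(B)$; moreover $r:=\mathrm{ch}_0(\mathscr{E})$ is an integer, and $$r^2-2r[\mathscr{E}]+[\mathscr{E}\otimes_{\mathscr{B}}\mathscr{E}]=0\quad\text{in }K_0(B),$$ where $r^2$ stands for $r^2\cdot 1$. -/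

import Mathlib

open scoped TensorProduct InnerProductSpace
open MulOpposite (op)

namespace NCBundle

/-! ### The group `K₀` of a unital ring, by idempotent matrices -/

section KTheory

variable {R : Type*} [Ring R]

/-- (Algebraic) Murray-von Neumann equivalence of square matrices, possibly of different sizes:
`p = u v` and `q = v u` for some rectangular matrices `u`, `v`. -/
def MvN {m n : Type*} [Fintype m] [Fintype n] (p : Matrix m m R) (q : Matrix n n R) : Prop :=
  ∃ (u : Matrix m n R) (v : Matrix n m R), u * v = p ∧ v * u = q

theorem MvN.refl {m : Type*} [Fintype m] {p : Matrix m m R} (hp : IsIdempotentElem p) :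
    MvN p p := ⟨p, p, hp, hp⟩

theorem MvN.symm {m n : Type*} [Fintype m] [Fintype n] {p : Matrix m m R} {q : Matrix n n R}
    (h : MvN p q) : MvN q p := by
  obtain ⟨u, v, h₁, h₂⟩ := h
  exact ⟨v, u, h₂, h₁⟩

theorem MvN.trans {l m n : Type*} [Fintype l] [Fintype m] [Fintype n] {p : Matrix l l R}
    {q : Matrix m m R} {r : Matrix n n R} (hp : IsIdempotentElem p) (hr : IsIdempotentElem r)
    (h : MvN p q) (h' : MvN q r) : MvN p r := by
  obtain ⟨u, v, h₁, h₂⟩ := h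
  obtain ⟨x, y, h₃, h₄⟩ := h'
  refine ⟨u * x, y * v, ?_, ?_⟩
  · calc u * x * (y * v) = u * (x * y) * v := by simp only [Matrix.mul_assoc]
      _ = (u * v) * (u * v) := by rw [h₃, ← h₂]; simp only [Matrix.mul_assoc]
      _ = p := by rw [h₁]; exact hp
  · calc y * v * (u * x) = y * (v * u) * x := by simp only [Matrix.mul_assoc]
      _ = (y * x) * (y * x) := by rw [h₂, ← h₃]; simp only [Matrix.mul_assoc]
      _ = r := by rw [h₄]; exact hr

theorem MvN.submatrix {m n : Type*} [Fintype m] [Fintype n] {p : Matrix n n R}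
    (hp : IsIdempotentElem p) (e : m ≃ n) : MvN (p.submatrix e e) p := by
  refine ⟨p.submatrix e id, p.submatrix id e, ?_, ?_⟩
  · have h := Matrix.submatrix_mul_equiv p p e (Equiv.refl n) e
    exact h.trans (congrArg (fun x => x.submatrix e e) hp)
  · rw [Matrix.submatrix_mul_equiv p p id e id]
    exact hp

/-- The block diagonal sum `p ⊕ q`. -/
def blockSum {m n : Type*} (p : Matrix m m R) (q : Matrix n n R) : Matrix (m ⊕ n) (m ⊕ n) R :=
  Matrix.fromBlocks p 0 0 q

theorem isIdempotentElem_blockSum {m n : Type*} [Fintype m] [Fintype n] {p : Matrix m m R}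
    {q : Matrix n n R} (hp : IsIdempotentElem p) (hq : IsIdempotentElem q) :
    IsIdempotentElem (blockSum p q) := by
  have hp' : p * p = p := hp
  have hq' : q * q = q := hq
  simp [IsIdempotentElem, blockSum, Matrix.fromBlocks_multiply, hp', hq']

theorem isIdempotentElem_submatrix {m n : Type*} [Fintype m] [Fintype n] {p : Matrix n n R}
    (hp : IsIdempotentElem p) (e : m ≃ n) : IsIdempotentElem (p.submatrix e e) := by
  have hp' : p * p = p := hp
  rw [IsIdempotentElem, Matrix.submatrix_mul_equiv, hp']

theorem MvN.blockSum {m n m' n' : Type*} [Fintype m] [Fintype n] [Fintype m'] [Fintype n']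
    {p : Matrix m m R} {q : Matrix n n R} {p' : Matrix m' m' R} {q' : Matrix n' n' R}
    (h : MvN p p') (h' : MvN q q') : MvN (blockSum p q) (blockSum p' q') := by
  obtain ⟨u, v, h₁, h₂⟩ := h
  obtain ⟨x, y, h₃, h₄⟩ := h'
  exact ⟨Matrix.fromBlocks u 0 0 x, Matrix.fromBlocks v 0 0 y, by
    simp [NCBundle.blockSum, Matrix.fromBlocks_multiply, h₁, h₃], by
    simp [NCBundle.blockSum, Matrix.fromBlocks_multiply, h₂, h₄]⟩

variable (R) in
/-- Idempotents in `M_∞(R)`: idempotent `n × n` matrices over `R`, for arbitrary `n`. -/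
structure IdemMatrix where
  size : ℕ
  mat : Matrix (Fin size) (Fin size) R
  idem : IsIdempotentElem mat

instance idemSetoid : Setoid (IdemMatrix R) where
  r p q := MvN p.mat q.mat
  iseqv :=
    { refl := fun p => MvN.refl p.idem
      symm := MvN.symm
      trans := fun {p _ r} h h' => MvN.trans p.idem r.idem h h' }

/-- The direct sum of two idempotent matrices. -/
def IdemMatrix.sum (p q : IdemMatrix R) : IdemMatrix R where
  size := p.size + q.size
  mat := (blockSum p.mat q.mat).submatrix finSumFinEquiv.symm finSumFinEquiv.symm
  idem := isIdempotentElem_submatrix (isIdempotentElem_blockSum p.idem q.idem) _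

theorem IdemMatrix.sum_mvN (p q : IdemMatrix R) :
    MvN (p.sum q).mat (blockSum p.mat q.mat) :=
  MvN.submatrix (isIdempotentElem_blockSum p.idem q.idem) _

/-- The empty matrix. -/
def IdemMatrix.empty : IdemMatrix R := ⟨0, 0, by simp [IsIdempotentElem]⟩

variable (R) in
/-- The abelian semigroup `V(R)` of equivalence classes of idempotents in `M_∞(R)`. -/
def VMonoid : Type _ := Quotient (idemSetoid (R := R))

theorem sum_congr {p p' q q' : IdemMatrix R} (h : MvN p.mat p'.mat) (h' : MvN q.mat q'.mat) :
    MvN (p.sum q).mat (p'.sum q').mat :=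
  MvN.trans (p.sum q).idem (p'.sum q').idem (p.sum_mvN q)
    (MvN.trans (isIdempotentElem_blockSum p.idem q.idem) (p'.sum q').idem
      (h.blockSum h') (p'.sum_mvN q').symm)

theorem sum_comm (p q : IdemMatrix R) : MvN (p.sum q).mat (q.sum p).mat := by
  refine MvN.trans (p.sum q).idem (q.sum p).idem (p.sum_mvN q) ?_
  refine MvN.trans (isIdempotentElem_blockSum p.idem q.idem) (q.sum p).idem ?_ (q.sum_mvN p).symm
  have h := MvN.submatrix (isIdempotentElem_blockSum q.idem p.idem) (Equiv.sumComm _ _)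
  have e : (blockSum q.mat p.mat).submatrix (Equiv.sumComm (Fin p.size) (Fin q.size))
      (Equiv.sumComm (Fin p.size) (Fin q.size)) = blockSum p.mat q.mat := by
    ext (i | i) (j | j) <;> rfl
  rwa [e] at h

theorem sum_assoc (p q r : IdemMatrix R) :
    MvN ((p.sum q).sum r).mat (p.sum (q.sum r)).mat := by
  have hpq := isIdempotentElem_blockSum p.idem q.idem
  have hqr := isIdempotentElem_blockSum q.idem r.idem
  have h₁ : MvN ((p.sum q).sum r).mat (blockSum (blockSum p.mat q.mat) r.mat) :=
    MvN.trans ((p.sum q).sum r).idem (isIdempotentElem_blockSum hpq r.idem)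
      ((p.sum q).sum_mvN r) ((p.sum_mvN q).blockSum (MvN.refl r.idem))
  have h₂ : MvN (p.sum (q.sum r)).mat (blockSum p.mat (blockSum q.mat r.mat)) :=
    MvN.trans (p.sum (q.sum r)).idem (isIdempotentElem_blockSum p.idem hqr)
      (p.sum_mvN (q.sum r)) ((MvN.refl p.idem).blockSum (q.sum_mvN r))
  have h := MvN.submatrix (isIdempotentElem_blockSum p.idem hqr) (Equiv.sumAssoc _ _ _)
  have e : (blockSum p.mat (blockSum q.mat r.mat)).submatrix
      (Equiv.sumAssoc (Fin p.size) (Fin q.size) (Fin r.size))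
      (Equiv.sumAssoc (Fin p.size) (Fin q.size) (Fin r.size))
      = blockSum (blockSum p.mat q.mat) r.mat := by
    ext ((i | i) | i) ((j | j) | j) <;> rfl
  rw [e] at h
  exact MvN.trans ((p.sum q).sum r).idem (p.sum (q.sum r)).idem h₁
    (MvN.trans (isIdempotentElem_blockSum hpq r.idem) (p.sum (q.sum r)).idem h h₂.symm)

theorem empty_sum (p : IdemMatrix R) : MvN (IdemMatrix.empty.sum p).mat p.mat := by
  refine MvN.trans (IdemMatrix.empty.sum p).idem p.idem (IdemMatrix.empty.sum_mvN p) ?_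
  have h := MvN.submatrix p.idem (Equiv.emptySum (Fin 0) (Fin p.size))
  have e : p.mat.submatrix (Equiv.emptySum (Fin 0) (Fin p.size))
      (Equiv.emptySum (Fin 0) (Fin p.size)) = blockSum (0 : Matrix (Fin 0) (Fin 0) R) p.mat := by
    ext (i | i) (j | j)
    · exact i.elim0
    · exact i.elim0
    · exact j.elim0
    · rfl
  rwa [e] at h

instance : Add (VMonoid R) :=
  ⟨Quotient.map₂ IdemMatrix.sum (fun _ _ h _ _ h' => sum_congr h h')⟩

instance : Zero (VMonoid R) := ⟨Quotient.mk _ IdemMatrix.empty⟩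

instance : AddCommMonoid (VMonoid R) where
  add_assoc := by
    rintro ⟨p⟩ ⟨q⟩ ⟨r⟩
    exact Quotient.sound (sum_assoc p q r)
  add_comm := by
    rintro ⟨p⟩ ⟨q⟩
    exact Quotient.sound (sum_comm p q)
  zero_add := by
    rintro ⟨p⟩
    exact Quotient.sound (empty_sum p)
  add_zero := by
    rintro ⟨p⟩
    exact Quotient.sound (MvN.trans (p.sum IdemMatrix.empty).idem p.idem (sum_comm _ _)
      (empty_sum p))
  nsmul := nsmulRec

variable (R) in
/-- `K₀(R)`: the Grothendieck group of the semigroup of classes of idempotents in `M_∞(R)`. -/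
abbrev K0 : Type _ := Algebra.GrothendieckAddGroup (VMonoid R)

/-- The class in `K₀(R)` of an idempotent matrix. -/
def K0.mk {N : ℕ} (p : Matrix (Fin N) (Fin N) R) (hp : IsIdempotentElem p) : K0 R :=
  Algebra.GrothendieckAddGroup.of (Quotient.mk idemSetoid ⟨N, p, hp⟩ : VMonoid R)

variable (R) in
/-- The class of the unit of `R`. -/
def K0.unit : K0 R := K0.mk (1 : Matrix (Fin 1) (Fin 1) R) (by simp [IsIdempotentElem])

end KTheory

/-! ### Finitely generated projective right modules and idempotents

A right module over a ring `R` is a module over the opposite ring `Rᵐᵒᵖ`, where `op b • e`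
stands for `e b`. -/

section Modules

variable {R : Type*} [Ring R] (E : Type*) [AddCommGroup E] [Module Rᵐᵒᵖ E]

/-- Left multiplication by a matrix, as a map of right modules `Rᴺ → Rᴺ`. -/
def mulVecRight {N : ℕ} (p : Matrix (Fin N) (Fin N) R) : (Fin N → R) →ₗ[Rᵐᵒᵖ] (Fin N → R) where
  toFun x := p.mulVec x
  map_add' x y := Matrix.mulVec_add p x y
  map_smul' b x := by
    ext i
    simp [Matrix.mulVec, dotProduct, Finset.sum_mul, mul_assoc]

/-- `E ≅ p Rᴺ` as right modules, with `p ∈ M_N(R)` an idempotent. -/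
def IsPresentedBy {N : ℕ} (p : Matrix (Fin N) (Fin N) R) : Prop :=
  IsIdempotentElem p ∧ Nonempty (E ≃ₗ[Rᵐᵒᵖ] LinearMap.range (mulVecRight p))

theorem exists_dualBasis [Module.Finite Rᵐᵒᵖ E] [Module.Projective Rᵐᵒᵖ E] :
    ∃ (N : ℕ) (ξ : Fin N → E) (ψ : Fin N → (E →ₗ[Rᵐᵒᵖ] R)),
      ∀ e, ∑ i, op (ψ i e) • ξ i = e := by
  obtain ⟨N, f, hf⟩ := Module.Finite.exists_fin' Rᵐᵒᵖ E
  obtain ⟨s, hs⟩ := Module.projective_lifting_property f LinearMap.id hf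
  refine ⟨N, fun i => f (Pi.single i 1), fun i =>
    { toFun := fun e => (s e i).unop
      map_add' := by intro x y; simp
      map_smul' := by intro b x; simp }, fun e => ?_⟩
  have h : f (s e) = e := LinearMap.congr_fun hs e
  conv_rhs => rw [← h, ← Finset.univ_sum_single (s e), map_sum]
  refine Finset.sum_congr rfl fun i _ => ?_
  simp only [LinearMap.coe_mk, AddHom.coe_mk, MulOpposite.op_unop]
  rw [← map_smul, ← Pi.single_smul]
  simp

variable {E} in
theorem finite_projective_of_dualBasis {ι : Type*} [Fintype ι] (ξ : ι → E)
    (ψ : ι → (E →ₗ[Rᵐᵒᵖ] R)) (h : ∀ e, ∑ i, op (ψ i e) • ξ i = e) :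
    Module.Finite Rᵐᵒᵖ E ∧ Module.Projective Rᵐᵒᵖ E := by
  let s : (ι → Rᵐᵒᵖ) →ₗ[Rᵐᵒᵖ] E := Fintype.linearCombination Rᵐᵒᵖ ξ
  let i : E →ₗ[Rᵐᵒᵖ] (ι → Rᵐᵒᵖ) :=
    { toFun := fun e k => op (ψ k e)
      map_add' := by intro x y; ext; simp
      map_smul' := by intro b x; ext; simp }
  have hsi : s ∘ₗ i = LinearMap.id := by
    ext e
    simpa [s, i, Fintype.linearCombination_apply] using h e
  exact ⟨Module.Finite.of_surjective s fun e => ⟨i e, LinearMap.congr_fun hsi e⟩,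
    Module.Projective.of_split i s hsi⟩

theorem exists_isPresentedBy [Module.Finite Rᵐᵒᵖ E] [Module.Projective Rᵐᵒᵖ E] :
    ∃ (N : ℕ) (p : Matrix (Fin N) (Fin N) R), IsPresentedBy E p := by
  obtain ⟨N, ξ, ψ, h⟩ := exists_dualBasis (R := R) E
  let p : Matrix (Fin N) (Fin N) R := fun i j => ψ i (ξ j)
  have hψ : ∀ (x : Fin N → R) (i : Fin N),
      p.mulVec x i = ψ i (∑ j, op (x j) • ξ j) := by
    intro x i
    simp [Matrix.mulVec, dotProduct, p, map_sum]
  let Ψ : E →ₗ[Rᵐᵒᵖ] (Fin N → R) := LinearMap.pi ψ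
  have hΨ : ∀ e, p.mulVec (Ψ e) = Ψ e := by
    intro e
    ext i
    rw [hψ]
    simp [Ψ, h e]
  refine ⟨N, p, ?_, ⟨LinearEquiv.ofBijective
    (Ψ.codRestrict (LinearMap.range (mulVecRight p)) fun e => ⟨Ψ e, hΨ e⟩) ⟨?_, ?_⟩⟩⟩
  · ext i j
    have := congrFun (hΨ (ξ j)) i
    rw [Matrix.mul_apply]
    simpa [Matrix.mulVec, dotProduct, p, Ψ] using this
  · intro a b hab
    have hab' : Ψ a = Ψ b := congrArg Subtype.val hab
    rw [← h a, ← h b]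
    refine Finset.sum_congr rfl fun i _ => ?_
    have : ψ i a = ψ i b := congrFun hab' i
    rw [this]
  · rintro ⟨_, x, rfl⟩
    refine ⟨∑ j, op (x j) • ξ j, Subtype.ext ?_⟩
    ext i
    exact (hψ x i).symm

section Presentation

variable (R) [Module.Finite Rᵐᵒᵖ E] [Module.Projective Rᵐᵒᵖ E]

/-- The size of a chosen idempotent presenting `E`. -/
noncomputable def presentingSize : ℕ := (exists_isPresentedBy (R := R) E).choose

/-- A chosen idempotent `p ∈ M_N(R)` with `E ≅ p Rᴺ`. -/
noncomputable def presentingIdem : Matrix (Fin (presentingSize R E)) (Fin (presentingSize R E)) R :=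
  (exists_isPresentedBy (R := R) E).choose_spec.choose

theorem presentingIdem_spec : IsPresentedBy E (presentingIdem R E) :=
  (exists_isPresentedBy (R := R) E).choose_spec.choose_spec

end Presentation

theorem IsIdempotentElem.matrix_map {S F : Type*} [Ring S] [FunLike F R S] [RingHomClass F R S]
    (f : F) {N : ℕ} {p : Matrix (Fin N) (Fin N) R} (hp : IsIdempotentElem p) :
    IsIdempotentElem (p.map f) := by
  have hp' : p * p = p := hp
  have := Matrix.map_mul (L := p) (M := p) (f := (f : R →+* S))
  rw [hp'] at this
  exact this.symm

/-- The class in `K₀(S)` of a finitely generated projective right `R`-module `E ≅ p Rᴺ`, along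
a ring homomorphism `f : R → S`: the class of the idempotent `f(p)`. -/
noncomputable def moduleClass {S F : Type*} [Ring S] [FunLike F R S] [RingHomClass F R S] (f : F)
    [Module.Finite Rᵐᵒᵖ E] [Module.Projective Rᵐᵒᵖ E] : K0 S :=
  K0.mk ((presentingIdem R E).map f)
    (IsIdempotentElem.matrix_map f (presentingIdem_spec (R := R) E).1)

end Modules

/-! ### The tensor product over a (noncommutative) ring -/

section Tensor

variable (R : Type*) [Ring R] (E : Type*) [AddCommGroup E] [Module Rᵐᵒᵖ E]
  (F : Type*) [AddCommGroup F] [Module R F]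

/-- The relations `e b ⊗ f = e ⊗ b f`. -/
def balancedRel : Submodule ℤ (E ⊗[ℤ] F) :=
  Submodule.span ℤ {x | ∃ (e : E) (b : R) (f : F), x = (op b • e) ⊗ₜ[ℤ] f - e ⊗ₜ[ℤ] (b • f)}

/-- The tensor product `E ⊗_R F` of a right `R`-module `E` and a left `R`-module `F`. -/
def BTensor : Type _ := (E ⊗[ℤ] F) ⧸ balancedRel R E F

noncomputable instance : AddCommGroup (BTensor R E F) :=
  inferInstanceAs (AddCommGroup ((E ⊗[ℤ] F) ⧸ balancedRel R E F))

variable {E F}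

/-- The elementary tensor `e ⊗_R f`. -/
def BTensor.tmul (e : E) (f : F) : BTensor R E F :=
  Submodule.Quotient.mk (p := balancedRel R E F) (e ⊗ₜ[ℤ] f)

variable {R}

theorem BTensor.induction {P : BTensor R E F → Prop} (zero : P 0)
    (tmul : ∀ e f, P (BTensor.tmul R e f)) (add : ∀ x y, P x → P y → P (x + y)) :
    ∀ x, P x := by
  intro x
  obtain ⟨t, rfl⟩ := Submodule.Quotient.mk_surjective (balancedRel R E F) x
  induction t with
  | zero => exact zero
  | tmul e f => exact tmul e f
  | add a b ha hb => exact add _ _ ha hb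

theorem BTensor.tmul_add (e : E) (f f' : F) :
    BTensor.tmul R e (f + f') = BTensor.tmul R e f + BTensor.tmul R e f' :=
  congrArg (Submodule.Quotient.mk (p := balancedRel R E F)) (TensorProduct.tmul_add e f f')

theorem BTensor.add_tmul (e e' : E) (f : F) :
    BTensor.tmul R (e + e') f = BTensor.tmul R e f + BTensor.tmul R e' f :=
  congrArg (Submodule.Quotient.mk (p := balancedRel R E F)) (TensorProduct.add_tmul e e' f)

theorem BTensor.smul_tmul (e : E) (b : R) (f : F) :
    BTensor.tmul R (op b • e) f = BTensor.tmul R e (b • f) :=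
  (Submodule.Quotient.eq (balancedRel R E F)).2 (Submodule.subset_span ⟨e, b, f, rfl⟩)

/-- The homomorphism on `E ⊗_R F` induced by a balanced biadditive map. -/
noncomputable def BTensor.lift {M : Type*} [AddCommGroup M] (φ : E →+ F →+ M)
    (h : ∀ (e : E) (b : R) (f : F), φ (op b • e) f = φ e (b • f)) : BTensor R E F →+ M :=
  ((balancedRel R E F).liftQ
    (TensorProduct.liftAddHom φ (fun n e f => by simp)).toIntLinearMap (by
      rw [balancedRel, Submodule.span_le]
      rintro _ ⟨e, b, f, rfl⟩
      simp [h])).toAddMonoidHom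

@[simp]
theorem BTensor.lift_tmul {M : Type*} [AddCommGroup M] (φ : E →+ F →+ M)
    (h : ∀ (e : E) (b : R) (f : F), φ (op b • e) f = φ e (b • f)) (e : E) (f : F) :
    BTensor.lift φ h (BTensor.tmul R e f) = φ e f := rfl

variable (R E) in
/-- `id ⊗ g` for an endomorphism `g` of the second factor. -/
noncomputable def BTensor.mapRight (g : F →ₗ[R] F) : BTensor R E F →+ BTensor R E F :=
  BTensor.lift
    (AddMonoidHom.mk' (fun e => AddMonoidHom.mk' (fun f => BTensor.tmul R e (g f))
      (fun f f' => by rw [map_add, BTensor.tmul_add]))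
      (fun e e' => by ext f; exact BTensor.add_tmul e e' (g f)))
    (fun e b f => by
      change BTensor.tmul R (op b • e) (g f) = BTensor.tmul R e (g (b • f))
      rw [BTensor.smul_tmul, map_smul])

@[simp]
theorem BTensor.mapRight_tmul (g : F →ₗ[R] F) (e : E) (f : F) :
    BTensor.mapRight R E g (BTensor.tmul R e f) = BTensor.tmul R e (g f) := rfl

/-- The right module structure `(e ⊗ f) s = e ⊗ (f s)`, if `F` is an `R`-`S`-bimodule. -/
noncomputable instance {S : Type*} [Ring S] [Module Sᵐᵒᵖ F] [SMulCommClass R Sᵐᵒᵖ F] :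
    Module Sᵐᵒᵖ (BTensor R E F) where
  smul s x := BTensor.mapRight R E
    { toFun := fun f => s • f
      map_add' := fun f f' => smul_add s f f'
      map_smul' := fun b f => smul_comm s b f (self := SMulCommClass.symm R Sᵐᵒᵖ F) } x
  one_smul x := by
    change BTensor.mapRight R E _ x = x
    induction x using BTensor.induction with
    | zero => simp
    | tmul e f => simp
    | add x y hx hy => rw [map_add, hx, hy]
  mul_smul s t x := by
    change BTensor.mapRight R E _ x = BTensor.mapRight R E _ (BTensor.mapRight R E _ x)
    induction x using BTensor.induction with
    | zero => simp
    | tmul e f => simp [mul_smul]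
    | add x y hx hy => simp only [map_add, hx, hy]
  smul_zero s := map_zero (BTensor.mapRight R E _)
  smul_add s x y := map_add (BTensor.mapRight R E _) x y
  add_smul s t x := by
    change BTensor.mapRight R E _ x = BTensor.mapRight R E _ x + BTensor.mapRight R E _ x
    induction x using BTensor.induction with
    | zero => simp
    | tmul e f => simp [add_smul, BTensor.tmul_add]
    | add x y hx hy => simp only [map_add, hx, hy]; abel
  zero_smul x := by
    change BTensor.mapRight R E _ x = 0
    induction x using BTensor.induction with
    | zero => simp
    | tmul e f =>
      have h := BTensor.tmul_add (R := R) e (0 : F) 0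
      rw [add_zero] at h
      simpa using h
    | add x y hx hy => simp only [map_add, hx, hy, add_zero]

theorem BTensor.op_smul_tmul {S : Type*} [Ring S] [Module Sᵐᵒᵖ F] [SMulCommClass R Sᵐᵒᵖ F]
    (s : Sᵐᵒᵖ) (e : E) (f : F) : s • BTensor.tmul R e f = BTensor.tmul R e (s • f) := rfl

/-- If `E` and `F` are finitely generated projective on the right, then so is `E ⊗_R F`. -/
theorem BTensor.finite_projective [Module Rᵐᵒᵖ F] [SMulCommClass R Rᵐᵒᵖ F]
    [Module.Finite Rᵐᵒᵖ E] [Module.Projective Rᵐᵒᵖ E]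
    [Module.Finite Rᵐᵒᵖ F] [Module.Projective Rᵐᵒᵖ F] :
    Module.Finite Rᵐᵒᵖ (BTensor R E F) ∧ Module.Projective Rᵐᵒᵖ (BTensor R E F) := by
  obtain ⟨N, ξ, ψ, h⟩ := exists_dualBasis (R := R) E
  obtain ⟨N', ξ', ψ', h'⟩ := exists_dualBasis (R := R) F
  let Θ : Fin N × Fin N' → (BTensor R E F →+ R) := fun jk =>
    BTensor.lift
      (AddMonoidHom.mk' (fun e => AddMonoidHom.mk' (fun f => ψ' jk.2 (ψ jk.1 e • f))
        (fun f f' => by rw [smul_add, map_add]))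
        (fun e e' => by ext f; simp [add_smul]))
      (fun e b f => by
        change ψ' jk.2 (ψ jk.1 (op b • e) • f) = ψ' jk.2 (ψ jk.1 e • b • f)
        simp [mul_smul])
  have hΘ : ∀ jk e f, Θ jk (BTensor.tmul R e f) = ψ' jk.2 (ψ jk.1 e • f) := fun _ _ _ => rfl
  let Ψ : Fin N × Fin N' → (BTensor R E F →ₗ[Rᵐᵒᵖ] R) := fun jk =>
    { toFun := Θ jk
      map_add' := map_add (Θ jk)
      map_smul' := by
        intro s x
        induction x using BTensor.induction with
        | zero => simp
        | tmul e f =>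
          rw [BTensor.op_smul_tmul, hΘ, hΘ, smul_comm, map_smul]
          rfl
        | add x y hx hy =>
          rw [smul_add, map_add, hx, hy, map_add, smul_add] }
  refine finite_projective_of_dualBasis
    (fun jk : Fin N × Fin N' => BTensor.tmul R (ξ jk.1) (ξ' jk.2)) Ψ fun x => ?_
  induction x using BTensor.induction with
  | zero => simp
  | tmul e f =>
    have tmul_sum : ∀ (e : E) (g : Fin N' → F),
        BTensor.tmul R e (∑ k, g k) = ∑ k, BTensor.tmul R e (g k) := fun e g =>
      map_sum (AddMonoidHom.mk' (BTensor.tmul R e) (BTensor.tmul_add e)) g _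
    have sum_tmul : ∀ (g : Fin N → E) (f : F),
        BTensor.tmul R (∑ k, g k) f = ∑ k, BTensor.tmul R (g k) f := fun g f =>
      map_sum (AddMonoidHom.mk' (fun e => BTensor.tmul R e f)
        (fun e e' => BTensor.add_tmul e e' f)) g _
    calc ∑ jk : Fin N × Fin N',
          op (Ψ jk (BTensor.tmul R e f)) • BTensor.tmul R (ξ jk.1) (ξ' jk.2)
        = ∑ j, ∑ k, BTensor.tmul R (ξ j) (op (ψ' k (ψ j e • f)) • ξ' k) := by
          rw [Fintype.sum_prod_type]; rfl
      _ = ∑ j, BTensor.tmul R (ξ j) (ψ j e • f) := by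
          refine Finset.sum_congr rfl fun j _ => ?_
          rw [← tmul_sum, h']
      _ = BTensor.tmul R e f := by
          conv_rhs => rw [← h e, sum_tmul]
          exact Finset.sum_congr rfl fun j _ => (BTensor.smul_tmul _ _ _).symm
  | add x y hx hy =>
    conv_rhs => rw [← hx, ← hy]
    rw [← Finset.sum_add_distrib]
    refine Finset.sum_congr rfl fun jk _ => ?_
    rw [map_add, MulOpposite.op_add, add_smul]

instance [Module Rᵐᵒᵖ F] [SMulCommClass R Rᵐᵒᵖ F]
    [Module.Finite Rᵐᵒᵖ E] [Module.Projective Rᵐᵒᵖ E]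
    [Module.Finite Rᵐᵒᵖ F] [Module.Projective Rᵐᵒᵖ F] : Module.Finite Rᵐᵒᵖ (BTensor R E F) :=
  BTensor.finite_projective.1

instance [Module Rᵐᵒᵖ F] [SMulCommClass R Rᵐᵒᵖ F]
    [Module.Finite Rᵐᵒᵖ E] [Module.Projective Rᵐᵒᵖ E]
    [Module.Finite Rᵐᵒᵖ F] [Module.Projective Rᵐᵒᵖ F] : Module.Projective Rᵐᵒᵖ (BTensor R E F) :=
  BTensor.finite_projective.2

end Tensor

/-! ### C*-enveloping algebras -/

section Envelope

variable {R : Type*} [Ring R] [Algebra ℂ R] [StarRing R]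

/-- C*-seminorms on a *-algebra. -/
structure IsCStarSeminorm (s : Seminorm ℂ R) : Prop where
  mul_le : ∀ a b, s (a * b) ≤ s a * s b
  star_mul_self : ∀ a, s (star a * a) = s a ^ 2

/-- `ι : R → B` exhibits the C*-algebra `B` as the C*-enveloping algebra of the *-algebra `R`: it
is the (Hausdorff) completion of `R` for the largest C*-seminorm. As `a ↦ ‖ι a‖` is itself a
C*-seminorm, this says that `ι` has dense range and that every C*-seminorm on `R` is bounded by
`a ↦ ‖ι a‖`. -/
structure IsCStarEnvelope {B : Type*} [CStarAlgebra B] (ι : R →⋆ₐ[ℂ] B) : Prop where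
  dense : DenseRange ι
  le_norm : ∀ s : Seminorm ℂ R, IsCStarSeminorm s → ∀ a, s a ≤ ‖ι a‖

end Envelope

/-! ### Trace class operators -/

section TraceClass

variable {H : Type*} [NormedAddCommGroup H] [InnerProductSpace ℂ H]

/-- Trace class operators `ℒ¹(H)`: the operators `T = ∑ₙ ⟨xₙ, ·⟩ yₙ` with
`∑ₙ ‖xₙ‖ ‖yₙ‖ < ∞`. -/
def IsTraceClass (T : H →L[ℂ] H) : Prop :=
  ∃ x y : ℕ → H, Summable (fun n => ‖x n‖ * ‖y n‖) ∧
    ∀ z, HasSum (fun n => ⟪x n, z⟫_ℂ • y n) (T z)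

/-- The trace `∑ᵢ ⟨eᵢ, T eᵢ⟩` of a trace class operator, for an orthonormal basis `(eᵢ)` of `H`
(the sum does not depend on it). -/
noncomputable def opTrace [CompleteSpace H] (T : H →L[ℂ] H) : ℂ :=
  ∑' i : (exists_hilbertBasis ℂ H).choose,
    ⟪(exists_hilbertBasis ℂ H).choose_spec.choose i,
      T ((exists_hilbertBasis ℂ H).choose_spec.choose i)⟫_ℂ

end TraceClass

/-! ### Bundles that trivialize over `A`, and their characteristic numbers -/

section Bundles

variable {A : Type*} [Ring A] [StarRing A] [Algebra ℂ A] [StarModule ℂ A]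
  (B : StarSubalgebra ℂ A)

/-- The `B`-bimodule `E` trivializes over `A`: for some `r` there is an isomorphism
`Φ : E ⊗_B A ≅ Aʳ` of `B`-`A`-bimodules, i.e. an isomorphism of right `A`-modules that also respects
the left action of `B`, which on `Aʳ` is the entrywise left multiplication. (So `e ↦ Φ (e ⊗ 1)`
identifies `E` with a sub-`B`-bimodule of `Aʳ`.)

The bimodules that are finitely generated and projective as right `B`-modules and trivialize
over `A` form `Vect_A(B)`. -/
def TrivializesOver (E : Type*) [AddCommGroup E] [Module B E] [Module Bᵐᵒᵖ E]
    [SMulCommClass B Bᵐᵒᵖ E] : Prop :=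
  ∃ (r : ℕ) (Φ : BTensor B E A ≃ₗ[Aᵐᵒᵖ] (Fin r → A)),
    ∀ (b : B) (e : E) (a : A), Φ (BTensor.tmul B (b • e) a) = b • Φ (BTensor.tmul B e a)

variable {B}

/-- `ch₀(E) = ε(Tr p)` for `E ≅ p Bᴺ`. -/
noncomputable def ch0 (ε : A →⋆ₐ[ℂ] ℂ) (E : Type*) [AddCommGroup E] [Module Bᵐᵒᵖ E]
    [Module.Finite Bᵐᵒᵖ E] [Module.Projective Bᵐᵒᵖ E] : ℂ :=
  ε ((presentingIdem B E).trace : B)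

/-- `ch₁(E) = Tr_H(π(Tr p) - ε(Tr p))` for `E ≅ p Bᴺ`. -/
noncomputable def ch1 {H : Type*} [NormedAddCommGroup H] [InnerProductSpace ℂ H] [CompleteSpace H]
    (ε : A →⋆ₐ[ℂ] ℂ) (π : A →⋆ₐ[ℂ] (H →L[ℂ] H)) (E : Type*) [AddCommGroup E] [Module Bᵐᵒᵖ E]
    [Module.Finite Bᵐᵒᵖ E] [Module.Projective Bᵐᵒᵖ E] : ℂ :=
  opTrace (π ((presentingIdem B E).trace : B) -
    ε ((presentingIdem B E).trace : B) • (1 : H →L[ℂ] H))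

end Bundles

end NCBundle

/-! The numbers `ch0` and `ch1` come from two additive maps `g, f : K0 C →+ ℂ` with integer values:
the map induced by the character `ε`, and the index pairing with the Fredholm module `(π, ε)`. On
the unit `(g, f)` is `(1, 0)`, and on the class of `E` it is `(r, ±1)`. Hence `(g, f)` maps `K0 C`
onto `ℤ²`. As `K0 C` is itself isomorphic to `ℤ²`, this surjection is an isomorphism. So the unit
and the class of `E` form a basis, and a relation in `K0 C` may be checked on its two numbers
(`rankTwo_basis`).

The numbers of `E ⊗ E` come from the trivialization. In a dual basis of `E`, left multiplication by
`b` has the matrix `U b V` over `A`, where `V U = 1` has size `r` and `U V` is the idempotent of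
`E`. Let `t` be the trace of that idempotent. The trace `t'` of an idempotent of `E ⊗ E` is then the
trace of `U t V`. Applying `ε` gives `ch₀(E) = r` and `ch₀(E ⊗ E) = r²`. With `X = π(t) - ε(t)`, the
operator `π(t') - ε(t')` is the matrix trace of `π(U) X π(V)` plus `ε(t) X`, so cyclicity of the
operator trace gives `ch₁(E ⊗ E) = 2 r ch₁(E)`. The relation follows from `r² - 2r·r + r² = 0` and
`-2r ch₁(E) + 2r ch₁(E) = 0`.

The analytic core is that the index pairing lives on `K0 C` and is integral, although its trace
formula makes sense only for idempotents over scalars plus trace class. Both representations extend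
to `C`, with values in scalars plus compacts. There each idempotent is equivalent to one over
scalars plus finite rank (`exists_mvN_scalarPlus`), whose reduced trace is an integer by
finite-dimensional linear algebra (`exists_int_sum_opTrace`). The value does not depend on the
representative: scalars plus trace class is dense and inverse closed, so equivalences can be
realized inside it, where the trace is cyclic (`IsTraceOn.reducedTrace_eq`). -/

namespace NCBundle

/-! ### Trace class operators and their trace -/

section TraceIdeal

variable {H : Type*} [NormedAddCommGroup H] [InnerProductSpace ℂ H]

/-- `T = ∑ₙ ⟨xₙ, ·⟩ yₙ` is a nuclear expansion of `T`. -/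
def IsNuclearExpansion (T : H →L[ℂ] H) (x y : ℕ → H) : Prop :=
  Summable (fun n => ‖x n‖ * ‖y n‖) ∧ ∀ z, HasSum (fun n => ⟪x n, z⟫_ℂ • y n) (T z)

/-- Cauchy-Schwarz combined with Bessel's inequality; this is the absolute convergence behind Fubini
for the trace. -/
theorem sum_norm_inner_mul_inner_le {κ : Type*} {e : κ → H} (he : Orthonormal ℂ e) (x y : H)
    (s : Finset κ) : ∑ i ∈ s, ‖⟪x, e i⟫_ℂ * ⟪e i, y⟫_ℂ‖ ≤ ‖x‖ * ‖y‖ := by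
  have hx : ∑ i ∈ s, ‖⟪x, e i⟫_ℂ‖ ^ 2 ≤ ‖x‖ ^ 2 := by
    simpa only [norm_inner_symm x] using he.sum_inner_products_le (s := s) x
  have hy : ∑ i ∈ s, ‖⟪e i, y⟫_ℂ‖ ^ 2 ≤ ‖y‖ ^ 2 := he.sum_inner_products_le (s := s) y
  simp only [norm_mul]
  refine (Real.sum_mul_le_sqrt_mul_sqrt s _ _).trans ?_
  gcongr
  · exact Real.sqrt_le_iff.2 ⟨norm_nonneg _, hx⟩
  · exact Real.sqrt_le_iff.2 ⟨norm_nonneg _, hy⟩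

/-- Fubini exchanges the two sums, and Parseval evaluates the inner one. The right side does not
mention the basis and the left side does not mention the expansion, so the trace is independent of
both. -/
theorem IsNuclearExpansion.tsum_inner_hilbertBasis {κ : Type*} (e : HilbertBasis κ ℂ H)
    {T : H →L[ℂ] H} {x y : ℕ → H} (h : IsNuclearExpansion T x y) :
    ∑' i, ⟪e i, T (e i)⟫_ℂ = ∑' n, ⟪x n, y n⟫_ℂ := by
  have hsum : Summable (fun p : ℕ × κ => ⟪x p.1, e p.2⟫_ℂ * ⟪e p.2, y p.1⟫_ℂ) := by
    refine Summable.of_norm ?_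
    have hb := fun n => sum_norm_inner_mul_inner_le e.orthonormal (x n) (y n)
    have hs : ∀ n, Summable (fun i => ‖⟪x n, e i⟫_ℂ * ⟪e i, y n⟫_ℂ‖) := fun n =>
      summable_of_sum_le (fun _ => norm_nonneg _) (hb n)
    refine (summable_prod_of_nonneg fun _ => norm_nonneg _).2 ⟨hs, ?_⟩
    refine Summable.of_nonneg_of_le (fun n => tsum_nonneg fun _ => norm_nonneg _) (fun n => ?_) h.1
    exact (hs n).tsum_le_of_sum_le (hb n)
  have hcomm := Summable.tsum_comm (f := fun n i => ⟪x n, e i⟫_ℂ * ⟪e i, y n⟫_ℂ) hsum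
  calc ∑' i, ⟪e i, T (e i)⟫_ℂ = ∑' i, ∑' n, ⟪x n, e i⟫_ℂ * ⟪e i, y n⟫_ℂ := by
        refine tsum_congr fun i => ?_
        have := ((innerSL ℂ (e i)).hasSum (h.2 (e i))).tsum_eq
        simpa using this.symm
    _ = ∑' n, ∑' i, ⟪x n, e i⟫_ℂ * ⟪e i, y n⟫_ℂ := hcomm
    _ = ∑' n, ⟪x n, y n⟫_ℂ := tsum_congr fun n => (e.hasSum_inner_mul_inner _ _).tsum_eq

theorem IsNuclearExpansion.opTrace_eq [CompleteSpace H] {T : H →L[ℂ] H} {x y : ℕ → H}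
    (h : IsNuclearExpansion T x y) : opTrace T = ∑' n, ⟪x n, y n⟫_ℂ :=
  h.tsum_inner_hilbertBasis _

theorem IsNuclearExpansion.summable_inner {T : H →L[ℂ] H} {x y : ℕ → H}
    (h : IsNuclearExpansion T x y) : Summable (fun n => ⟪x n, y n⟫_ℂ) :=
  Summable.of_norm_bounded h.1 fun _ => norm_inner_le_norm _ _

theorem IsNuclearExpansion.mul_left {T : H →L[ℂ] H} {x y : ℕ → H}
    (h : IsNuclearExpansion T x y) (S : H →L[ℂ] H) :
    IsNuclearExpansion (S * T) x (fun n => S (y n)) := by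
  refine ⟨Summable.of_nonneg_of_le (fun n => by positivity) (fun n => ?_) (h.1.mul_left ‖S‖),
    fun z => ?_⟩
  · calc ‖x n‖ * ‖S (y n)‖ ≤ ‖x n‖ * (‖S‖ * ‖y n‖) := by gcongr; exact S.le_opNorm _
      _ = ‖S‖ * (‖x n‖ * ‖y n‖) := by ring
  · simpa using S.hasSum (h.2 z)

theorem IsNuclearExpansion.mul_right [CompleteSpace H] {T : H →L[ℂ] H} {x y : ℕ → H}
    (h : IsNuclearExpansion T x y) (S : H →L[ℂ] H) :
    IsNuclearExpansion (T * S) (fun n => ContinuousLinearMap.adjoint S (x n)) y := by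
  refine ⟨Summable.of_nonneg_of_le (fun n => by positivity) (fun n => ?_)
    (h.1.mul_left ‖ContinuousLinearMap.adjoint S‖), fun z => ?_⟩
  · calc ‖ContinuousLinearMap.adjoint S (x n)‖ * ‖y n‖
        ≤ (‖ContinuousLinearMap.adjoint S‖ * ‖x n‖) * ‖y n‖ := by
          gcongr; exact (ContinuousLinearMap.adjoint S).le_opNorm _
      _ = ‖ContinuousLinearMap.adjoint S‖ * (‖x n‖ * ‖y n‖) := by ring
  · simpa [ContinuousLinearMap.adjoint_inner_left] using h.2 (S z)

/-- Interleaving of two sequences. -/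
noncomputable def interleave (x x' : ℕ → H) : ℕ → H :=
  fun n => Sum.elim x x' (Equiv.natSumNatEquivNat.symm n)

theorem hasSum_natSum {M : Type*} [AddCommMonoid M] [TopologicalSpace M] [ContinuousAdd M]
    {f : ℕ ⊕ ℕ → M} {a b : M} (hf : HasSum (fun n => f (.inl n)) a)
    (hg : HasSum (fun n => f (.inr n)) b) :
    HasSum (fun n => f (Equiv.natSumNatEquivNat.symm n)) (a + b) :=
  (Equiv.natSumNatEquivNat.symm.hasSum_iff (f := f)).2 (HasSum.sum hf hg)

theorem IsNuclearExpansion.add {T T' : H →L[ℂ] H} {x y x' y' : ℕ → H}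
    (h : IsNuclearExpansion T x y) (h' : IsNuclearExpansion T' x' y') :
    IsNuclearExpansion (T + T') (interleave x x') (interleave y y') :=
  ⟨(hasSum_natSum (f := fun n => ‖Sum.elim x x' n‖ * ‖Sum.elim y y' n‖)
      h.1.hasSum h'.1.hasSum).summable,
    fun z => hasSum_natSum (f := fun n => ⟪Sum.elim x x' n, z⟫_ℂ • Sum.elim y y' n)
      (h.2 z) (h'.2 z)⟩

theorem IsTraceClass.add {T T' : H →L[ℂ] H} (h : IsTraceClass T) (h' : IsTraceClass T') :
    IsTraceClass (T + T') := by
  obtain ⟨x, y, h⟩ := h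
  obtain ⟨x', y', h'⟩ := h'
  exact ⟨_, _, IsNuclearExpansion.add h h'⟩

theorem IsTraceClass.mul_left {T : H →L[ℂ] H} (h : IsTraceClass T) (S : H →L[ℂ] H) :
    IsTraceClass (S * T) := by
  obtain ⟨x, y, h⟩ := h
  exact ⟨_, _, IsNuclearExpansion.mul_left h S⟩

theorem IsTraceClass.mul_right [CompleteSpace H] {T : H →L[ℂ] H} (h : IsTraceClass T)
    (S : H →L[ℂ] H) : IsTraceClass (T * S) := by
  obtain ⟨x, y, h⟩ := h
  exact ⟨_, _, IsNuclearExpansion.mul_right h S⟩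

theorem IsTraceClass.smul {T : H →L[ℂ] H} (h : IsTraceClass T) (c : ℂ) :
    IsTraceClass (c • T) := by
  simpa using h.mul_left (c • 1)

theorem isTraceClass_zero : IsTraceClass (0 : H →L[ℂ] H) :=
  ⟨0, 0, by simp, fun z => by simp⟩

theorem isNuclearExpansion_rankOne (x y : H) :
    IsNuclearExpansion ((innerSL ℂ x).smulRight y) (Pi.single 0 x) (Pi.single 0 y) := by
  constructor
  · refine summable_of_ne_finset_zero (s := {0}) fun n hn => ?_
    rw [Finset.notMem_singleton] at hn
    simp [Pi.single_eq_of_ne hn]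
  · intro z
    have := hasSum_single (f := fun n => ⟪(Pi.single 0 x : ℕ → H) n, z⟫_ℂ •
      (Pi.single 0 y : ℕ → H) n) 0 fun n hn => by simp [Pi.single_eq_of_ne hn]
    simpa using this

theorem isTraceClass_rankOne (x y : H) : IsTraceClass ((innerSL ℂ x).smulRight y) :=
  ⟨_, _, isNuclearExpansion_rankOne x y⟩

section Complete

variable [CompleteSpace H]

theorem opTrace_rankOne (x y : H) : opTrace ((innerSL ℂ x).smulRight y) = ⟪x, y⟫_ℂ := by
  rw [(isNuclearExpansion_rankOne x y).opTrace_eq, tsum_eq_single 0]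
  · simp
  · intro n hn
    simp [Pi.single_eq_of_ne hn]

theorem opTrace_add {T T' : H →L[ℂ] H} (h : IsTraceClass T) (h' : IsTraceClass T') :
    opTrace (T + T') = opTrace T + opTrace T' := by
  obtain ⟨x, y, h⟩ := h
  obtain ⟨x', y', h'⟩ := h'
  have h : IsNuclearExpansion T x y := h
  have h' : IsNuclearExpansion T' x' y' := h'
  rw [(h.add h').opTrace_eq, h.opTrace_eq, h'.opTrace_eq]
  exact (hasSum_natSum (f := fun n => ⟪Sum.elim x x' n, Sum.elim y y' n⟫_ℂ)
    h.summable_inner.hasSum h'.summable_inner.hasSum).tsum_eq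

/-- An expansion of `T` induces one of each product, and these have equal terms because `⟪x, S y⟫ =
⟪S* x, y⟫`. -/
theorem opTrace_mul_comm {T : H →L[ℂ] H} (h : IsTraceClass T) (S : H →L[ℂ] H) :
    opTrace (S * T) = opTrace (T * S) := by
  obtain ⟨x, y, h⟩ := h
  have h : IsNuclearExpansion T x y := h
  rw [(h.mul_left S).opTrace_eq, (h.mul_right S).opTrace_eq]
  simp [ContinuousLinearMap.adjoint_inner_left]

theorem opTrace_smul {T : H →L[ℂ] H} (h : IsTraceClass T) (c : ℂ) :
    opTrace (c • T) = c * opTrace T := by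
  obtain ⟨x, y, h⟩ := h
  have h : IsNuclearExpansion T x y := h
  have h' := h.mul_left (c • 1)
  simp only [Algebra.smul_mul_assoc, one_mul, _root_.smul_apply,
    one_apply_eq_self] at h'
  rw [h'.opTrace_eq, h.opTrace_eq, ← tsum_mul_left]
  simp

@[simp]
theorem opTrace_zero : opTrace (0 : H →L[ℂ] H) = 0 := by
  simp [opTrace]

end Complete

/-- The finite rank operators, i.e. the finite sums of operators `⟨x, ·⟩ y`. -/
def finiteRankSpan (H : Type*) [NormedAddCommGroup H] [InnerProductSpace ℂ H] :
    Submodule ℂ (H →L[ℂ] H) :=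
  Submodule.span ℂ (Set.range fun p : H × H => (innerSL ℂ p.1).smulRight p.2)

theorem rankOne_mem_finiteRankSpan (x y : H) :
    (innerSL ℂ x).smulRight y ∈ finiteRankSpan H :=
  Submodule.subset_span ⟨(x, y), rfl⟩

theorem mul_left_mem_finiteRankSpan (S : H →L[ℂ] H) {T : H →L[ℂ] H} (h : T ∈ finiteRankSpan H) :
    S * T ∈ finiteRankSpan H := by
  induction h using Submodule.span_induction with
  | mem T hT =>
    obtain ⟨⟨x, y⟩, rfl⟩ := hT
    convert rankOne_mem_finiteRankSpan x (S y) using 1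
    ext z
    simp
  | zero => simp
  | add T T' _ _ h h' => rw [mul_add]; exact add_mem h h'
  | smul c T _ h => rw [mul_smul_comm]; exact Submodule.smul_mem _ c h

theorem mul_right_mem_finiteRankSpan [CompleteSpace H] (S : H →L[ℂ] H) {T : H →L[ℂ] H}
    (h : T ∈ finiteRankSpan H) : T * S ∈ finiteRankSpan H := by
  induction h using Submodule.span_induction with
  | mem T hT =>
    obtain ⟨⟨x, y⟩, rfl⟩ := hT
    convert rankOne_mem_finiteRankSpan (ContinuousLinearMap.adjoint S x) y using 1
    ext z
    simp [ContinuousLinearMap.adjoint_inner_left]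
  | zero => simp
  | add T T' _ _ h h' => rw [add_mul]; exact add_mem h h'
  | smul c T _ h => rw [smul_mul_assoc]; exact Submodule.smul_mem _ c h

theorem isTraceClass_of_mem_finiteRankSpan {T : H →L[ℂ] H} (h : T ∈ finiteRankSpan H) :
    IsTraceClass T := by
  induction h using Submodule.span_induction with
  | mem T hT =>
    obtain ⟨⟨x, y⟩, rfl⟩ := hT
    exact isTraceClass_rankOne x y
  | zero => exact isTraceClass_zero
  | add T T' _ _ h h' => exact h.add h'
  | smul c T _ h => exact h.smul c

/-- The partial sums of a nuclear expansion converge in operator norm, since the tail of `∑ ‖xₙ‖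
‖yₙ‖` bounds the error. -/
theorem IsTraceClass.mem_closure {T : H →L[ℂ] H} (h : IsTraceClass T) :
    T ∈ (finiteRankSpan H).topologicalClosure := by
  obtain ⟨x, y, hs, h⟩ := h
  refine mem_closure_of_tendsto (f := fun N => ∑ n ∈ Finset.range N,
    (innerSL ℂ (x n)).smulRight (y n)) (b := Filter.atTop) ?_
    (Filter.Eventually.of_forall fun N => Submodule.sum_mem _ fun n _ =>
      rankOne_mem_finiteRankSpan _ _)
  rw [tendsto_iff_norm_sub_tendsto_zero]
  refine squeeze_zero (fun _ => norm_nonneg _) (fun N => ?_)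
    (_root_.tendsto_sum_nat_add fun n => ‖x n‖ * ‖y n‖)
  rw [norm_sub_rev]
  have hsN : Summable fun n => ‖x (n + N)‖ * ‖y (n + N)‖ := (summable_nat_add_iff N).2 hs
  refine ContinuousLinearMap.opNorm_le_bound _ (tsum_nonneg fun _ => by positivity) fun z => ?_
  have h1 : HasSum (fun n => ⟪x (n + N), z⟫_ℂ • y (n + N))
      ((T - ∑ n ∈ Finset.range N, (innerSL ℂ (x n)).smulRight (y n)) z) := by
    have := (hasSum_nat_add_iff' N).2 (h z)
    simpa [_root_.sum_apply] using this
  have hb : ∀ n, ‖⟪x (n + N), z⟫_ℂ • y (n + N)‖ ≤ (‖x (n + N)‖ * ‖y (n + N)‖) * ‖z‖ := fun n => by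
    rw [norm_smul]
    calc _ ≤ (‖x (n + N)‖ * ‖z‖) * ‖y (n + N)‖ := by gcongr; exact norm_inner_le_norm _ _
      _ = _ := by ring
  rw [← h1.tsum_eq, ← tsum_mul_right]
  exact tsum_of_norm_bounded (hsN.mul_right ‖z‖).hasSum hb

end TraceIdeal

/-! ### Integrality of traces of idempotents -/

section Integrality

theorem exists_int_trace_of_isIdempotentElem {n : Type*} [Fintype n] [DecidableEq n]
    {p : Matrix n n ℂ} (hp : IsIdempotentElem p) : ∃ m : ℤ, p.trace = m := by
  have hL : IsIdempotentElem (Matrix.toLin' p) := by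
    rw [IsIdempotentElem, Module.End.mul_eq_comp, ← Matrix.toLin'_mul, show p * p = p from hp]
  have htr := (LinearMap.isProj_range_iff_isIdempotentElem (Matrix.toLin' p)).2 hL |>.trace
  rw [Matrix.trace_toLin'_eq] at htr
  exact ⟨Module.finrank ℂ (LinearMap.range (Matrix.toLin' p)), by rw [htr]; simp⟩

theorem exists_int_sum_trace_of_isIdempotentElem {V : Type*} [AddCommGroup V] [Module ℂ V]
    [FiniteDimensional ℂ V] {n : Type*} [Fintype n] {p : Matrix n n (Module.End ℂ V)}
    (hp : IsIdempotentElem p) : ∃ m : ℤ, ∑ i, LinearMap.trace ℂ V (p i i) = m := by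
  classical
  let b := Module.finBasis ℂ V
  let f : Module.End ℂ V ≃ₐ[ℂ] Matrix _ _ ℂ := LinearMap.toMatrixAlgEquiv b
  have h1 : IsIdempotentElem (p.map f) := by
    rw [IsIdempotentElem, ← Matrix.map_mul, show p * p = p from hp]
  -- A matrix of endomorphisms of `V` is flattened to one block matrix over `ℂ`, whose trace is the
  -- sum in question.
  have h2 : IsIdempotentElem (Matrix.compRingEquiv _ _ ℂ (p.map f)) := by
    rw [IsIdempotentElem, ← map_mul, show p.map f * p.map f = p.map f from h1]
  obtain ⟨m, hm⟩ := exists_int_trace_of_isIdempotentElem h2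
  refine ⟨m, hm ▸ ?_⟩
  rw [Matrix.trace, Fintype.sum_prod_type]
  refine Finset.sum_congr rfl fun i _ => ?_
  rw [LinearMap.trace_eq_matrix_trace ℂ b]
  rfl

variable {H : Type*} [NormedAddCommGroup H] [InnerProductSpace ℂ H]

theorem finiteDimensional_range_of_mem_finiteRankSpan {T : H →L[ℂ] H}
    (h : T ∈ finiteRankSpan H) : FiniteDimensional ℂ (LinearMap.range (T : H →ₗ[ℂ] H)) := by
  induction h using Submodule.span_induction with
  | mem T hT =>
    obtain ⟨⟨x, y⟩, rfl⟩ := hT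
    refine Submodule.finiteDimensional_of_le (S₂ := Submodule.span ℂ {y}) ?_
    rintro _ ⟨z, rfl⟩
    exact Submodule.smul_mem _ _ (Submodule.mem_span_singleton_self y)
  | zero =>
    refine Submodule.finiteDimensional_of_le (S₂ := ⊥) ?_
    rintro _ ⟨z, rfl⟩
    simp
  | add T T' _ _ h h' =>
    refine Submodule.finiteDimensional_of_le (S₂ := LinearMap.range (T : H →ₗ[ℂ] H) ⊔
      LinearMap.range (T' : H →ₗ[ℂ] H)) ?_
    rintro _ ⟨z, rfl⟩
    exact Submodule.add_mem_sup ⟨z, rfl⟩ ⟨z, rfl⟩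
  | smul c T _ h =>
    refine Submodule.finiteDimensional_of_le (S₂ := LinearMap.range (T : H →ₗ[ℂ] H)) ?_
    rintro _ ⟨z, rfl⟩
    exact Submodule.smul_mem _ c ⟨z, rfl⟩

variable [CompleteSpace H]

theorem opTrace_sum {κ : Type*} (s : Finset κ) (T : κ → H →L[ℂ] H)
    (h : ∀ i ∈ s, IsTraceClass (T i)) :
    IsTraceClass (∑ i ∈ s, T i) ∧ opTrace (∑ i ∈ s, T i) = ∑ i ∈ s, opTrace (T i) := by
  classical
  induction s using Finset.induction_on with
  | empty => simpa using isTraceClass_zero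
  | insert a s ha ih =>
    obtain ⟨h1, h2⟩ := ih fun i hi => h i (Finset.mem_insert_of_mem hi)
    have h3 := h a (Finset.mem_insert_self a s)
    rw [Finset.sum_insert ha, Finset.sum_insert ha, opTrace_add h3 h1, h2]
    exact ⟨h3.add h1, rfl⟩

/-- For an orthonormal basis `e` of a space `V` containing the range, `T` is the finite sum of the
rank one operators `⟪T* eₖ, ·⟫ eₖ`, which have trace `⟪eₖ, T eₖ⟫`. -/
theorem opTrace_eq_trace_restrict (V : Submodule ℂ H) [FiniteDimensional ℂ V] {T : H →L[ℂ] H}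
    (hT : ∀ z, T z ∈ V) :
    opTrace T = LinearMap.trace ℂ V ((T : H →ₗ[ℂ] H).restrict fun z _ => hT z) := by
  let e := stdOrthonormalBasis ℂ V
  have hdec : T = ∑ k, (innerSL ℂ (ContinuousLinearMap.adjoint T (e k))).smulRight (e k : H) := by
    ext z
    have h := congrArg (Subtype.val) (e.sum_repr' ⟨T z, hT z⟩)
    simp only [Submodule.coe_sum, Submodule.coe_smul, Submodule.coe_inner] at h
    simpa [ContinuousLinearMap.adjoint_inner_left, _root_.sum_apply] using h.symm
  conv_lhs => rw [hdec]
  rw [(opTrace_sum _ _ fun k _ => isTraceClass_rankOne _ _).2, LinearMap.trace_eq_sum_inner _ e]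
  refine Finset.sum_congr rfl fun k _ => ?_
  rw [opTrace_rankOne, ContinuousLinearMap.adjoint_inner_left]
  rfl

/-- One finite-dimensional `V` contains the ranges of all entries of `P - Q`. The entries of `P`
preserve it, so `P` restricts to an idempotent on `Vⁿ`, and the sum is the trace of this restriction
minus `Tr Q · dim V`: a difference of integers. -/
theorem exists_int_sum_opTrace {n : Type*} [Fintype n] [DecidableEq n]
    {P : Matrix n n (H →L[ℂ] H)} {Q : Matrix n n ℂ} (hP : IsIdempotentElem P)
    (hQ : IsIdempotentElem Q) (h : ∀ i j, P i j - Q i j • (1 : H →L[ℂ] H) ∈ finiteRankSpan H) :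
    ∃ m : ℤ, ∑ i, opTrace (P i i - Q i i • (1 : H →L[ℂ] H)) = m := by
  let D : n × n → (H →ₗ[ℂ] H) := fun k => ((P k.1 k.2 - Q k.1 k.2 • (1 : H →L[ℂ] H) : H →L[ℂ] H))
  let V : Submodule ℂ H := ⨆ k, LinearMap.range (D k)
  have := fun k : n × n => finiteDimensional_range_of_mem_finiteRankSpan (h k.1 k.2)
  have : FiniteDimensional ℂ V := Submodule.finiteDimensional_iSup fun k => LinearMap.range (D k)
  have hDV : ∀ i j z, (P i j - Q i j • (1 : H →L[ℂ] H)) z ∈ V := fun i j z =>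
    Submodule.mem_iSup_of_mem (p := fun k => LinearMap.range (D k)) (i, j) ⟨z, rfl⟩
  have hPV : ∀ i j, ∀ z ∈ V, (P i j : H →ₗ[ℂ] H) z ∈ V := fun i j z hz => by
    have := V.add_mem (hDV i j z) (V.smul_mem (Q i j) hz)
    simpa using this
  let p : Matrix n n (Module.End ℂ V) := fun i j => (P i j : H →ₗ[ℂ] H).restrict (hPV i j)
  have hp : IsIdempotentElem p := by
    ext i j z
    have := congrArg (fun M : Matrix n n (H →L[ℂ] H) => M i j (z : H)) hP
    change (((p * p) i j) z : H) = P i j z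
    rw [Matrix.mul_apply]
    simp only [Matrix.mul_apply, _root_.sum_apply] at this
    rw [LinearMap.sum_apply, Submodule.coe_sum]
    exact this
  obtain ⟨m, hm⟩ := exists_int_sum_trace_of_isIdempotentElem hp
  obtain ⟨r, hr⟩ := exists_int_trace_of_isIdempotentElem hQ
  refine ⟨m - r * Module.finrank ℂ V, ?_⟩
  calc ∑ i, opTrace (P i i - Q i i • (1 : H →L[ℂ] H))
      = ∑ i, (LinearMap.trace ℂ V (p i i) - Q i i * Module.finrank ℂ V) := by
        refine Finset.sum_congr rfl fun i _ => ?_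
        rw [opTrace_eq_trace_restrict V (hDV i i), ← LinearMap.trace_one ℂ V, ← smul_eq_mul,
          ← map_smul, ← map_sub]
        congr 1
    _ = _ := by
        rw [Finset.sum_sub_distrib, hm, ← Finset.sum_mul]
        rw [Matrix.trace] at hr
        simp only [Matrix.diag_apply] at hr
        rw [hr]
        push_cast
        rfl

end Integrality

/-! ### Perturbing idempotents in a Banach algebra -/

section BanachAlgebra

open Filter Topology

variable {M : Type*} [NormedRing M] [CompleteSpace M]

/-- The small solution of `y - y² = t`, for small `t`; it commutes with all that commutes
with `t`. -/
theorem exists_eq_add_mul_self {t : M} (ht : ‖t‖ ≤ 1 / 8) :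
    ∃ y : M, y = t + y * y ∧ ‖y‖ ≤ 2 * ‖t‖ ∧ ∀ a, Commute a t → Commute a y := by
  -- Banach's fixed point theorem for `y ↦ t + y²` on this set. On the ball of radius `2‖t‖` the
  -- Lipschitz constant is at most `4‖t‖ ≤ 1/2`, and `‖t‖ + 4‖t‖² ≤ 2‖t‖`. Commutation is a closed
  -- condition kept by the map, so the fixed point inherits it.
  let s : Set M := {y | ‖y‖ ≤ 2 * ‖t‖ ∧ ∀ a, Commute a t → Commute a y}
  have hs : IsClosed s := by
    have : s = {y | ‖y‖ ≤ 2 * ‖t‖} ∩ ⋂ a ∈ {a | Commute a t}, {y | a * y = y * a} := by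
      ext y
      simp [s, Commute, SemiconjBy]
    rw [this]
    exact (isClosed_le continuous_norm continuous_const).inter (isClosed_biInter fun a _ =>
      isClosed_eq (continuous_const.mul continuous_id) (continuous_id.mul continuous_const))
  let f : M → M := fun y => t + y * y
  have hf : Set.MapsTo f s s := by
    rintro y ⟨hy, hc⟩
    refine ⟨?_, fun a ha => ha.add_right ((hc a ha).mul_right (hc a ha))⟩
    have h1 : ‖y * y‖ ≤ ‖y‖ * ‖y‖ := norm_mul_le y y
    have h2 : ‖t + y * y‖ ≤ ‖t‖ + ‖y * y‖ := norm_add_le _ _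
    change ‖t + y * y‖ ≤ _
    nlinarith [norm_nonneg y, norm_nonneg t]
  have hcontr : ContractingWith (1 / 2) (hf.restrict f s s) := by
    refine ⟨by norm_num, LipschitzWith.of_dist_le_mul ?_⟩
    rintro ⟨y, hy, _⟩ ⟨z, hz, _⟩
    change dist (t + y * y) (t + z * z) ≤ _ * dist y z
    rw [dist_eq_norm, dist_eq_norm]
    have h1 : t + y * y - (t + z * z) = y * (y - z) + (y - z) * z := by noncomm_ring
    have h2 : ‖y * (y - z) + (y - z) * z‖ ≤ ‖y‖ * ‖y - z‖ + ‖y - z‖ * ‖z‖ :=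
      (norm_add_le _ _).trans (add_le_add (norm_mul_le _ _) (norm_mul_le _ _))
    rw [h1]
    push_cast
    nlinarith [norm_nonneg (y - z)]
  obtain ⟨y, hy, hfix, -⟩ := hcontr.exists_fixedPoint' hs.isComplete hf (x := 0)
    ⟨by simp, fun a _ => Commute.zero_right a⟩ (edist_ne_top _ _)
  exact ⟨y, hfix.symm, hy.1, hy.2⟩

/-- With `d = a² - a` one has `(1 - 2a)² = 1 + 4d`. So for `y` commuting with `a`, the defect of `a
+ (1 - 2a) y` from being idempotent is `d - (1 + 4d)(y - y²)`. It vanishes when `y - y² = d / (1 +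
4d)`, an algebraic substitute for functional calculus. -/
theorem isIdempotentElem_add_mul {R : Type*} [Ring R] {a t y : R} (hay : Commute a y)
    (hy : y = t + y * y) (ht : (1 + 4 * (a * a - a)) * t = a * a - a) :
    IsIdempotentElem (a + (1 - 2 * a) * y) := by
  have hby : y * (1 - 2 * a) = (1 - 2 * a) * y := by
    have := hay.eq
    rw [mul_sub, sub_mul, mul_one, one_mul, two_mul, mul_add, add_mul, this]
  have h1 : (a + (1 - 2 * a) * y) * (a + (1 - 2 * a) * y) - (a + (1 - 2 * a) * y)
      = (a * a - a) - (1 + 4 * (a * a - a)) * (y - y * y) := by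
    calc _ = a * a + a * (1 - 2 * a) * y + (1 - 2 * a) * (y * a)
          + (1 - 2 * a) * (y * (1 - 2 * a)) * y - (a + (1 - 2 * a) * y) := by noncomm_ring
      _ = a * a + a * (1 - 2 * a) * y + (1 - 2 * a) * (a * y)
          + (1 - 2 * a) * ((1 - 2 * a) * y) * y - (a + (1 - 2 * a) * y) := by rw [hby, hay.eq]
      _ = _ := by noncomm_ring
  have h2 : y - y * y = t := by rw [sub_eq_iff_eq_add]; exact hy
  rw [h2, ht, sub_self, sub_eq_zero] at h1
  exact h1

/-- The element `w = e p + (1 - e)(1 - p)` satisfies `e w = e p = w p`, so when invertible it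
conjugates `p` to `e`. -/
theorem mvN_witness_of_isUnit {R : Type*} [Ring R] {e p : R} (he : IsIdempotentElem e)
    (hp : IsIdempotentElem p) (hw : IsUnit (e * p + (1 - e) * (1 - p))) :
    ∃ u v : R, u * v = e ∧ v * u = p := by
  obtain ⟨w, hw⟩ := hw
  have he' : e * e = e := he
  have hp' : p * p = p := hp
  have h1 : e * w = e * p := by
    rw [hw, mul_add, ← mul_assoc, ← mul_assoc, he', show e * (1 - e) = 0 from he.mul_one_sub_self,
      zero_mul, add_zero]
  have h2 : w * p = e * p := by
    rw [hw, add_mul, mul_assoc, mul_assoc, hp', show (1 - p) * p = 0 from hp.one_sub_mul_self,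
      mul_zero, add_zero]
  refine ⟨e * p, p * ↑w⁻¹, ?_, ?_⟩
  · rw [← mul_assoc, mul_assoc e, hp', ← h1, mul_assoc, Units.mul_inv, mul_one]
  · rw [← h2, mul_assoc, ← mul_assoc _ _ p, Units.inv_mul, one_mul, hp']

/-- An idempotent that is congruent to the idempotent `Q` modulo the closure of an ideal `J` is
equivalent to one that is congruent to `Q` modulo `J`. -/
theorem exists_isIdempotentElem_sub_mem (J : AddSubgroup M) (hl : ∀ a, ∀ x ∈ J, a * x ∈ J)
    (hr : ∀ a, ∀ x ∈ J, x * a ∈ J) {P Q : M} (hP : IsIdempotentElem P) (hQ : IsIdempotentElem Q)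
    (hPQ : P - Q ∈ closure (J : Set M)) :
    ∃ E : M, IsIdempotentElem E ∧ E - Q ∈ J ∧ ∃ u v : M, u * v = E ∧ v * u = P := by
  obtain ⟨T, hTJ, hT⟩ := mem_closure_iff_seq_limit.1 hPQ
  let a : ℕ → M := fun k => Q + T k
  have ha : Tendsto a atTop (𝓝 P) := by simpa [a] using hT.const_add Q
  let d : ℕ → M := fun k => a k * a k - a k
  have hd : Tendsto d atTop (𝓝 0) := by
    have := (ha.mul ha).sub ha
    rwa [show P * P = P from hP, sub_self] at this
  have hs : Tendsto (fun k => 1 + 4 * d k) atTop (𝓝 ((1 : Mˣ) : M)) := by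
    simpa using (hd.const_mul 4).const_add 1
  have hsu : ∀ᶠ k in atTop, IsUnit (1 + 4 * d k) := hs.eventually (Units.nhds 1)
  have hsi : Tendsto (fun k => Ring.inverse (1 + 4 * d k)) atTop (𝓝 1) := by
    simpa [Function.comp_def] using (NormedRing.inverse_continuousAt (1 : Mˣ)).tendsto.comp hs
  let t : ℕ → M := fun k => d k * Ring.inverse (1 + 4 * d k)
  have ht : Tendsto t atTop (𝓝 0) := by simpa using hd.mul hsi
  have htn : Tendsto (fun k => ‖t k‖) atTop (𝓝 0) := by simpa using ht.norm
  have hts : ∀ᶠ k in atTop, ‖t k‖ ≤ 1 / 8 := htn.eventually (ge_mem_nhds (by norm_num))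
  -- The small root exists only for small `t k`; the value 0 elsewhere is never used, as `t k` is
  -- eventually small.
  have key : ∀ k, ∃ y : M, ‖t k‖ ≤ 1 / 8 →
      y = t k + y * y ∧ ‖y‖ ≤ 2 * ‖t k‖ ∧ ∀ a, Commute a (t k) → Commute a y := fun k => by
    by_cases h : ‖t k‖ ≤ 1 / 8
    · obtain ⟨y, hy⟩ := exists_eq_add_mul_self h
      exact ⟨y, fun _ => hy⟩
    · exact ⟨0, fun h' => absurd h' h⟩
  choose y hy using key
  have hy0 : Tendsto y atTop (𝓝 0) := by
    refine squeeze_zero_norm' (hts.mono fun k hk => (hy k hk).2.1) ?_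
    simpa using htn.const_mul 2
  let e : ℕ → M := fun k => a k + (1 - 2 * a k) * y k
  have he : Tendsto e atTop (𝓝 P) := by
    simpa using ha.add (((ha.const_mul 2).const_sub 1).mul hy0)
  have hw : Tendsto (fun k => e k * P + (1 - e k) * (1 - P)) atTop (𝓝 ((1 : Mˣ) : M)) := by
    have h := (he.mul_const P).add ((he.const_sub 1).mul_const (1 - P))
    rwa [show P * P = P from hP, show (1 - P) * (1 - P) = 1 - P from hP.one_sub,
      add_sub_cancel] at h
  have hwu : ∀ᶠ k in atTop, IsUnit (e k * P + (1 - e k) * (1 - P)) := hw.eventually (Units.nhds 1)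
  obtain ⟨k, hku, hkt, hkw⟩ := (hsu.and (hts.and hwu)).exists
  obtain ⟨hy1, hy2, hy3⟩ := hy k hkt
  have hcad : Commute (a k) (d k) :=
    ((Commute.refl (a k)).mul_right (Commute.refl (a k))).sub_right (Commute.refl _)
  have hcas : Commute (a k) (1 + 4 * d k) :=
    (Commute.one_right _).add_right ((Commute.ofNat_right _ 4).mul_right hcad)
  have hcds : Commute (d k) (1 + 4 * d k) :=
    (Commute.one_right _).add_right ((Commute.ofNat_right _ 4).mul_right (Commute.refl _))
  have hcai : Commute (a k) (Ring.inverse (1 + 4 * d k)) := by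
    obtain ⟨w, hw⟩ := hku
    rw [← hw] at hcas ⊢
    rw [Ring.inverse_unit]
    exact hcas.units_inv_right
  have hE : IsIdempotentElem (e k) := by
    refine isIdempotentElem_add_mul (hy3 _ (hcad.mul_right hcai)) hy1 ?_
    change (1 + 4 * d k) * (d k * Ring.inverse (1 + 4 * d k)) = d k
    rw [← mul_assoc, ← hcds.eq, mul_assoc, Ring.mul_inverse_cancel _ hku, mul_one]
  refine ⟨e k, hE, ?_, mvN_witness_of_isUnit hE hP hkw⟩
  -- Expanding `(Q + T)² - (Q + T)` with `Q² = Q` leaves only terms containing `T`.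
  have hdJ : d k ∈ J := by
    have : d k = Q * T k + T k * Q + T k * T k - T k := by
      have hQ' : Q * Q = Q := hQ
      simp only [d, a, mul_add, add_mul, hQ']
      abel
    rw [this]
    exact J.sub_mem (J.add_mem (J.add_mem (hl _ _ (hTJ k)) (hr _ _ (hTJ k))) (hl _ _ (hTJ k)))
      (hTJ k)
  -- Although `y` arises as a limit and `J` need not be closed, `y (1 - y) = t` with `1 - y`
  -- invertible gives `y = t (1 - y)⁻¹`, which lies in the ideal.
  have hyJ : y k ∈ J := by
    have hlt : ‖y k‖ < 1 := by linarith
    have h1 : y k * (1 - y k) = t k := by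
      rw [mul_sub, mul_one, sub_eq_iff_eq_add]; exact hy1
    have h2 : y k = t k * ↑(Units.oneSub (y k) hlt)⁻¹ := by
      rw [Units.eq_mul_inv_iff_mul_eq, Units.val_oneSub, h1]
    rw [h2]
    exact hr _ _ (hr _ _ hdJ)
  have : e k - Q = T k + (1 - 2 * a k) * y k := by simp only [e, a]; abel
  rw [this]
  exact J.add_mem (hTJ k) (hl _ _ hyJ)

theorem IsIdempotentElem.eq_zero_of_norm_lt_one {R : Type*} [NormedRing R] {p : R}
    (hp : IsIdempotentElem p) (h : ‖p‖ < 1) : p = 0 := by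
  by_contra h0
  have h1 : ‖p‖ ≤ ‖p‖ * ‖p‖ := by
    conv_lhs => rw [← show p * p = p from hp]
    exact norm_mul_le p p
  nlinarith [norm_pos_iff.2 h0]

end BanachAlgebra

/-! ### Equivalence of idempotents over a dense, inverse closed subring -/

section DenseSubring

open Filter Topology
open scoped Matrix.Norms.Operator

variable {D : Type*} [NormedRing D]

theorem tendsto_matrix_mul {l m n : Type*} [Fintype m] {u : ℕ → Matrix l m D}
    {v : ℕ → Matrix m n D} {a : Matrix l m D} {b : Matrix m n D}
    (hu : ∀ i j, Tendsto (fun k => u k i j) atTop (𝓝 (a i j)))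
    (hv : ∀ i j, Tendsto (fun k => v k i j) atTop (𝓝 (b i j))) (i : l) (j : n) :
    Tendsto (fun k => (u k * v k) i j) atTop (𝓝 ((a * b) i j)) := by
  simp only [Matrix.mul_apply]
  exact tendsto_finsetSum _ fun x _ => (hu i x).mul (hv x j)

theorem tendsto_matrix {m n : Type*} [Fintype m] [Fintype n] {u : ℕ → Matrix m n D}
    {a : Matrix m n D} : Tendsto u atTop (𝓝 a) ↔
      ∀ i j, Tendsto (fun k => u k i j) atTop (𝓝 (a i j)) := by
  exact tendsto_pi_nhds.trans (forall_congr' fun i => tendsto_pi_nhds)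

theorem matrix_mul_mem (S : Subring D) {l m n : Type*} [Fintype m] {x : Matrix l m D}
    {y : Matrix m n D} (hx : ∀ i j, x i j ∈ S) (hy : ∀ i j, y i j ∈ S) (i : l) (j : n) :
    (x * y) i j ∈ S := by
  rw [Matrix.mul_apply]
  exact S.sum_mem fun k _ => S.mul_mem (hx i k) (hy k j)

theorem hasSummableGeomSeries_matrix [CompleteSpace D] {m : Type*} [Fintype m] [DecidableEq m] :
    HasSummableGeomSeries (Matrix m m D) := by
  have : CompleteSpace (Matrix m m D) := inferInstanceAs (CompleteSpace (m → m → D))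
  exact @instHasSummableGeomSeriesOfCompleteSpace _ _ this

/-- Idempotents over a dense, matricially inverse closed subring that are equivalent over the
whole algebra are equivalent over the subring. -/
theorem exists_mvN_witness_mem [CompleteSpace D] (S : Subring D) (hS : Dense (S : Set D))
    {m n : Type*} [Fintype m] [Fintype n] [DecidableEq m] [DecidableEq n]
    (hinv : ∀ x y : Matrix m m D, (∀ i j, x i j ∈ S) → x * y = 1 → y * x = 1 → ∀ i j, y i j ∈ S)
    {p : Matrix m m D} {q : Matrix n n D} (hp : IsIdempotentElem p) (hq : IsIdempotentElem q)
    (hpS : ∀ i j, p i j ∈ S) (hqS : ∀ i j, q i j ∈ S) (h : MvN p q) :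
    ∃ (u : Matrix m n D) (v : Matrix n m D), (∀ i j, u i j ∈ S) ∧ (∀ i j, v i j ∈ S) ∧
      u * v = p ∧ v * u = q := by
  obtain ⟨u, v, huv, hvu⟩ := h
  have hp' : p * p = p := hp
  have hq' : q * q = q := hq
  have := hasSummableGeomSeries_matrix (D := D) (m := m)
  choose s hsS hs using fun d : D => mem_closure_iff_seq_limit.1 (hS d)
  let u' : ℕ → Matrix m n D := fun k i j => s (u i j) k
  let v' : ℕ → Matrix n m D := fun k i j => s (v i j) k
  -- The approximations over `S` are cut down by `p` and `q`, so that only the two products still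
  -- have to be corrected.
  let x : ℕ → Matrix m n D := fun k => p * u' k * q
  let y : ℕ → Matrix n m D := fun k => q * v' k * p
  have hxS : ∀ k i j, x k i j ∈ S := fun k =>
    matrix_mul_mem S (matrix_mul_mem S hpS fun i j => hsS _ k) hqS
  have hyS : ∀ k i j, y k i j ∈ S := fun k =>
    matrix_mul_mem S (matrix_mul_mem S hqS fun i j => hsS _ k) hpS
  have hx : ∀ i j, Tendsto (fun k => x k i j) atTop (𝓝 ((p * u * q) i j)) :=
    tendsto_matrix_mul (tendsto_matrix_mul (fun _ _ => tendsto_const_nhds) fun i j => hs (u i j))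
      fun _ _ => tendsto_const_nhds
  have hy : ∀ i j, Tendsto (fun k => y k i j) atTop (𝓝 ((q * v * p) i j)) :=
    tendsto_matrix_mul (tendsto_matrix_mul (fun _ _ => tendsto_const_nhds) fun i j => hs (v i j))
      fun _ _ => tendsto_const_nhds
  have hxy : p * u * q * (q * v * p) = p := by
    calc _ = p * u * (q * q) * v * p := by simp only [Matrix.mul_assoc]
      _ = p * (u * v) * (u * v) * p := by rw [hq', ← hvu]; simp only [Matrix.mul_assoc]
      _ = p := by rw [huv, hp', hp', hp']
  have hyx : q * v * p * (p * u * q) = q := by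
    calc _ = q * v * (p * p) * u * q := by simp only [Matrix.mul_assoc]
      _ = q * (v * u) * (v * u) * q := by rw [hp', ← huv]; simp only [Matrix.mul_assoc]
      _ = q := by rw [hvu, hq', hq', hq']
  -- The product `x y` is close to `p`, the unit of its corner; adding `1 - p` makes it close to 1,
  -- so it can be inverted in the full matrix ring, where inverse closedness applies.
  let z : ℕ → Matrix m m D := fun k => x k * y k + (1 - p)
  have hz : Tendsto z atTop (𝓝 ((1 : (Matrix m m D)ˣ) : Matrix m m D)) := by
    have h : Tendsto (fun k => x k * y k) atTop (𝓝 p) := by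
      rw [← hxy]
      exact tendsto_matrix.2 (tendsto_matrix_mul hx hy)
    simpa using h.add_const (1 - p)
  have hzu : ∀ᶠ k in atTop, IsUnit (z k) := hz.eventually (Units.nhds 1)
  let w : ℕ → Matrix m m D := fun k => Ring.inverse (z k)
  have hw : Tendsto w atTop (𝓝 1) := by
    have h := (NormedRing.inverse_continuousAt (1 : (Matrix m m D)ˣ)).tendsto.comp hz
    rw [Units.val_one, Ring.inverse_one] at h
    exact h
  -- Replacing `y` by `y w` makes the first product exactly `p`. The second product `r` is then an
  -- idempotent below `q` and near it; so `q - r` is an idempotent of norm less than 1, hence zero.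
  let r : ℕ → Matrix n n D := fun k => y k * w k * x k
  have hr : Tendsto (fun k => q - r k) atTop (𝓝 0) := by
    have h : Tendsto r atTop (𝓝 q) := by
      have := tendsto_matrix.2 (tendsto_matrix_mul (tendsto_matrix_mul hy (tendsto_matrix.1 hw)) hx)
      rwa [Matrix.mul_one, hyx] at this
    simpa using h.const_sub q
  have hrn : ∀ᶠ k in atTop, ‖q - r k‖ < 1 := by
    have := hr.norm
    rw [norm_zero] at this
    exact this.eventually (gt_mem_nhds one_pos)
  obtain ⟨k, hku, hk⟩ := (hzu.and hrn).exists
  have hzw : z k * w k = 1 := Ring.mul_inverse_cancel _ hku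
  have hwz : w k * z k = 1 := Ring.inverse_mul_cancel _ hku
  have hpx : p * x k = x k := by
    simp only [x, ← Matrix.mul_assoc, hp']
  have hxq : x k * q = x k := by
    simp only [x, Matrix.mul_assoc, hq']
  have hqy : q * y k = y k := by
    simp only [y, ← Matrix.mul_assoc, hq']
  have hpz : p * z k = x k * y k := by
    simp only [z, mul_add, mul_sub, mul_one, hp', ← Matrix.mul_assoc, hpx]
    abel
  have hxyw : x k * (y k * w k) = p := by
    rw [← Matrix.mul_assoc, ← hpz, mul_assoc, hzw, mul_one]
  have hrr : r k * r k = r k := by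
    calc r k * r k = y k * w k * (x k * (y k * w k)) * x k := by simp only [r, Matrix.mul_assoc]
      _ = r k := by rw [hxyw, Matrix.mul_assoc _ p, hpx]
  have hqr : q * r k = r k := by
    simp only [r, ← Matrix.mul_assoc, hqy]
  have hrq : r k * q = r k := by
    simp only [r, Matrix.mul_assoc, hxq]
  have hqr0 : q - r k = 0 := by
    refine IsIdempotentElem.eq_zero_of_norm_lt_one ?_ hk
    simp only [IsIdempotentElem, sub_mul, mul_sub, hrr, hqr, hrq, hq', sub_self, sub_zero]
  have hzS : ∀ i j, z k i j ∈ S := fun i j => by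
    refine S.add_mem (matrix_mul_mem S (hxS k) (hyS k) i j) (S.sub_mem ?_ (hpS i j))
    rw [Matrix.one_apply]
    split_ifs
    exacts [S.one_mem, S.zero_mem]
  exact ⟨x k, y k * w k, hxS k, matrix_mul_mem S (hyS k) (hinv _ _ hzS hzw hwz), hxyw,
    (sub_eq_zero.1 hqr0).symm⟩

end DenseSubring

/-! ### Homomorphisms out of `K₀` -/

section MatrixOverIdeal

variable {R : Type*} [Ring R]

theorem MvN.map {S F : Type*} [Ring S] [FunLike F R S] [RingHomClass F R S] (f : F)
    {m n : Type*} [Fintype m] [Fintype n] {p : Matrix m m R} {q : Matrix n n R} (h : MvN p q) :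
    MvN (p.map f) (q.map f) := by
  obtain ⟨u, v, rfl, rfl⟩ := h
  refine ⟨u.map f, v.map f, ?_, ?_⟩
  · exact (Matrix.map_mul (L := u) (M := v) (f := (f : R →+* S))).symm
  · exact (Matrix.map_mul (L := v) (M := u) (f := (f : R →+* S))).symm

theorem isIdempotentElem_map {S F : Type*} [Ring S] [FunLike F R S] [RingHomClass F R S] (f : F)
    {m : Type*} [Fintype m] {p : Matrix m m R} (h : IsIdempotentElem p) :
    IsIdempotentElem (p.map f) := by
  have := Matrix.map_mul (L := p) (M := p) (f := (f : R →+* S))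
  rw [show p * p = p from h] at this
  exact this.symm

/-- A homomorphism on `K₀` from an additive invariant of idempotent matrices. -/
noncomputable def K0.lift {G : Type*} [AddCommGroup G] (g : IdemMatrix R → G)
    (hg : ∀ p q, MvN p.mat q.mat → g p = g q) (hadd : ∀ p q, g (p.sum q) = g p + g q) :
    K0 R →+ G :=
  Algebra.GrothendieckAddGroup.lift
    (AddMonoidHom.mk' (M := VMonoid R) (Quotient.lift g hg) (by
      rintro ⟨p⟩ ⟨q⟩
      exact hadd p q))

theorem K0.lift_mk {G : Type*} [AddCommGroup G] (g : IdemMatrix R → G)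
    (hg : ∀ p q, MvN p.mat q.mat → g p = g q) (hadd : ∀ p q, g (p.sum q) = g p + g q)
    {N : ℕ} (p : Matrix (Fin N) (Fin N) R) (hp : IsIdempotentElem p) :
    K0.lift g hg hadd (K0.mk p hp) = g ⟨N, p, hp⟩ := by
  let a : VMonoid R := Quotient.mk idemSetoid ⟨N, p, hp⟩
  exact DFunLike.congr_fun
    ((Algebra.GrothendieckAddGroup.lift (M := VMonoid R) (G := G)).symm_apply_apply _) a

/-- Every element of `K₀` is a difference of two classes of idempotents. This is used to pass
integrality from idempotents to all of `K₀`. -/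
theorem K0.lift_mem {G : Type*} [AddCommGroup G] (g : IdemMatrix R → G)
    (hg : ∀ p q, MvN p.mat q.mat → g p = g q) (hadd : ∀ p q, g (p.sum q) = g p + g q)
    (G' : AddSubgroup G) (h : ∀ p, g p ∈ G') (x : K0 R) : K0.lift g hg hadd x ∈ G' := by
  have h' : ∀ a : VMonoid R, Quotient.lift g hg a ∈ G' := by
    rintro ⟨p⟩
    exact h p
  rw [K0.lift, Algebra.GrothendieckAddGroup.lift_apply]
  exact G'.sub_mem (h' _) (h' _)

end MatrixOverIdeal

/-! ### Reduced traces over scalars plus an ideal -/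

section ScalarPlusIdeal

open Filter Topology
open scoped Matrix.Norms.Operator

variable {D : Type*} [NormedRing D] [NormedAlgebra ℂ D] (χ : D →ₐ[ℂ] ℂ)

/-- The subring `ℂ + I`, for a two-sided ideal `I` and a character `χ` that vanishes on `I`. -/
def scalarPlus (I : Ideal D) [I.IsTwoSided] : Subring D where
  carrier := {d | d - algebraMap ℂ D (χ d) ∈ I}
  mul_mem' := by
    intro a b ha hb
    have h : a * b - algebraMap ℂ D (χ (a * b))
        = a * (b - algebraMap ℂ D (χ b)) + (a - algebraMap ℂ D (χ a)) * algebraMap ℂ D (χ b) := by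
      rw [map_mul, map_mul]; noncomm_ring
    change _ ∈ I
    rw [h]
    exact I.add_mem (I.mul_mem_left _ hb) (I.mul_mem_right _ ha)
  one_mem' := by simp
  add_mem' := by
    intro a b ha hb
    have h : a + b - algebraMap ℂ D (χ (a + b))
        = (a - algebraMap ℂ D (χ a)) + (b - algebraMap ℂ D (χ b)) := by
      rw [map_add, map_add]; abel
    change _ ∈ I
    rw [h]
    exact I.add_mem ha hb
  zero_mem' := by simp
  neg_mem' := by
    intro a ha
    have h : -a - algebraMap ℂ D (χ (-a)) = -(a - algebraMap ℂ D (χ a)) := by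
      rw [map_neg, map_neg]; abel
    change _ ∈ I
    rw [h]
    exact I.neg_mem ha

variable {χ} {I : Ideal D} [I.IsTwoSided]

theorem mem_scalarPlus {d : D} : d ∈ scalarPlus χ I ↔ d - algebraMap ℂ D (χ d) ∈ I := Iff.rfl

theorem scalarPlus_mono {J : Ideal D} [J.IsTwoSided] (h : I ≤ J) :
    scalarPlus χ I ≤ scalarPlus χ J := fun _ hd => h hd

theorem add_algebraMap_mem_scalarPlus (hI : ∀ x ∈ I, χ x = 0) {x : D} (hx : x ∈ I) (c : ℂ) :
    x + algebraMap ℂ D c ∈ scalarPlus χ I := by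
  rw [mem_scalarPlus, map_add, hI x hx, AlgHom.commutes, zero_add, Algebra.algebraMap_self,
    RingHom.id_apply, add_sub_cancel_right]
  exact hx

theorem dense_scalarPlus (hI : ∀ x ∈ I, χ x = 0)
    (hd : ∀ d, d - algebraMap ℂ D (χ d) ∈ closure (I : Set D)) :
    Dense (scalarPlus χ I : Set D) := by
  intro d
  obtain ⟨x, hx, hlim⟩ := mem_closure_iff_seq_limit.1 (hd d)
  refine mem_closure_iff_seq_limit.2 ⟨fun k => x k + algebraMap ℂ D (χ d),
    fun k => add_algebraMap_mem_scalarPlus hI (hx k) _, ?_⟩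
  simpa using hlim.add_const (algebraMap ℂ D (χ d))

/-- Writing `χ` for its entrywise application, `y - χ(y) = -y (x - χ(x)) χ(y)`, and the middle
factor has entries in the ideal. No topology enters. -/
theorem scalarPlus_inv_mem {m : Type*} [Fintype m] [DecidableEq m] (x y : Matrix m m D)
    (hx : ∀ i j, x i j ∈ scalarPlus χ I) (hxy : x * y = 1) (hyx : y * x = 1) (i j : m) :
    y i j ∈ scalarPlus χ I := by
  let f : D →+* D := (algebraMap ℂ D).comp χ.toRingHom
  have hf : x.map f * y.map f = 1 := by
    rw [← Matrix.map_mul, hxy, Matrix.map_one f (map_zero f) (map_one f)]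
  have h : y - y.map f = -(y * ((x - x.map f) * y.map f)) := by
    rw [sub_mul, hf, mul_sub, mul_one, ← mul_assoc, hyx, one_mul, neg_sub]
  have h' := congrFun (congrFun h i) j
  rw [mem_scalarPlus]
  change (y - y.map f) i j ∈ I
  rw [h', Matrix.neg_apply, Matrix.mul_apply]
  refine I.neg_mem (I.sum_mem fun k _ => I.mul_mem_left _ ?_)
  rw [Matrix.mul_apply]
  exact I.sum_mem fun l _ => I.mul_mem_right _ (hx k l)

/-- The scalar matrix `χ(p)` is an idempotent congruent to `p` modulo the closure of the matrices
over `I`, so `exists_isIdempotentElem_sub_mem` applies with `Q = χ(p)`. -/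
theorem exists_mvN_scalarPlus [CompleteSpace D]
    (hd : ∀ d, d - algebraMap ℂ D (χ d) ∈ closure (I : Set D)) (hI : ∀ x ∈ I, χ x = 0)
    {m : Type*} [Fintype m] [DecidableEq m] {p : Matrix m m D} (hp : IsIdempotentElem p) :
    ∃ e : Matrix m m D, IsIdempotentElem e ∧ (∀ i j, e i j ∈ scalarPlus χ I) ∧ MvN p e := by
  let f : D →+* D := (algebraMap ℂ D).comp χ.toRingHom
  have : CompleteSpace (Matrix m m D) := inferInstanceAs (CompleteSpace (m → m → D))
  let J : AddSubgroup (Matrix m m D) :=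
    { carrier := {x | ∀ i j, x i j ∈ I}
      add_mem' := fun ha hb i j => I.add_mem (ha i j) (hb i j)
      zero_mem' := fun i j => I.zero_mem
      neg_mem' := fun ha i j => I.neg_mem (ha i j) }
  have hl : ∀ a, ∀ x ∈ J, a * x ∈ J := fun a x hx i j => by
    rw [Matrix.mul_apply]
    exact I.sum_mem fun k _ => I.mul_mem_left _ (hx k j)
  have hr : ∀ a, ∀ x ∈ J, x * a ∈ J := fun a x hx i j => by
    rw [Matrix.mul_apply]
    exact I.sum_mem fun k _ => I.mul_mem_right _ (hx i k)
  have hcl : p - p.map f ∈ closure (J : Set (Matrix m m D)) := by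
    choose x hx hlim using fun i j => mem_closure_iff_seq_limit.1 (hd (p i j))
    exact mem_closure_of_tendsto (f := fun k i j => x i j k) (tendsto_matrix.2 hlim)
      (Eventually.of_forall fun k i j => hx i j k)
  obtain ⟨e, he, heJ, u, v, huv, hvu⟩ := @exists_isIdempotentElem_sub_mem (Matrix m m D) _ this
    J hl hr p (p.map f) hp (isIdempotentElem_map f hp) hcl
  refine ⟨e, he, fun i j => ?_, v, u, hvu, huv⟩
  have := add_algebraMap_mem_scalarPlus hI (heJ i j) (χ (p i j))
  simpa [f] using this

variable (χ) in
/-- `τ` of an element of `ℂ + I` reduced modulo scalars, summed over the diagonal. -/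
noncomputable def reducedTrace (τ : D → ℂ) {m : Type*} [Fintype m] (p : Matrix m m D) : ℂ :=
  ∑ i, τ (p i i - algebraMap ℂ D (χ (p i i)))

/-- An additive functional on an ideal that vanishes on commutators. -/
structure IsTraceOn {R : Type*} [Ring R] (I : Ideal R) (τ : R → ℂ) : Prop where
  zero : τ 0 = 0
  add : ∀ x ∈ I, ∀ y ∈ I, τ (x + y) = τ x + τ y
  comm : ∀ x ∈ I, ∀ y, τ (x * y) = τ (y * x)

theorem IsTraceOn.sum {R : Type*} [Ring R] {I : Ideal R} {τ : R → ℂ} (hτ : IsTraceOn I τ)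
    {κ : Type*} (s : Finset κ) (x : κ → R) (hx : ∀ i ∈ s, x i ∈ I) :
    τ (∑ i ∈ s, x i) = ∑ i ∈ s, τ (x i) := by
  classical
  induction s using Finset.induction_on with
  | empty => simpa using hτ.zero
  | insert a s ha ih =>
    have h1 := fun i hi => hx i (Finset.mem_insert_of_mem hi)
    rw [Finset.sum_insert ha, Finset.sum_insert ha,
      hτ.add _ (hx a (Finset.mem_insert_self a s)) _ (I.sum_mem h1), ih h1]

variable {τ : D → ℂ}

theorem IsTraceOn.comm_scalarPlus (hτ : IsTraceOn I τ) {a b : D} (ha : a ∈ scalarPlus χ I)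
    (hb : b ∈ scalarPlus χ I) :
    τ (a * b - algebraMap ℂ D (χ (a * b))) = τ (b * a - algebraMap ℂ D (χ (b * a))) := by
  have key : ∀ a b : D, a * b - algebraMap ℂ D (χ (a * b))
      = (a - algebraMap ℂ D (χ a)) * b + algebraMap ℂ D (χ a) * (b - algebraMap ℂ D (χ b)) := by
    intro a b
    rw [map_mul, map_mul]; noncomm_ring
  have key' : b * a - algebraMap ℂ D (χ (b * a))
      = b * (a - algebraMap ℂ D (χ a)) + (b - algebraMap ℂ D (χ b)) * algebraMap ℂ D (χ a) := by
    rw [map_mul, map_mul]; noncomm_ring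
  rw [key a b, key', hτ.add _ (I.mul_mem_right _ ha) _ (I.mul_mem_left _ hb),
    hτ.add _ (I.mul_mem_left _ ha) _ (I.mul_mem_right _ hb), hτ.comm _ ha, hτ.comm _ hb]

theorem IsTraceOn.reducedTrace_mul_comm (hτ : IsTraceOn I τ) {m n : Type*} [Fintype m] [Fintype n]
    {u : Matrix m n D} {v : Matrix n m D} (hu : ∀ i j, u i j ∈ scalarPlus χ I)
    (hv : ∀ i j, v i j ∈ scalarPlus χ I) :
    reducedTrace χ τ (u * v) = reducedTrace χ τ (v * u) := by
  have h1 : ∀ i j, u i j * v j i - algebraMap ℂ D (χ (u i j * v j i)) ∈ I := fun i j =>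
    (scalarPlus χ I).mul_mem (hu i j) (hv j i)
  have h2 : ∀ i j, v i j * u j i - algebraMap ℂ D (χ (v i j * u j i)) ∈ I := fun i j =>
    (scalarPlus χ I).mul_mem (hv i j) (hu j i)
  simp only [reducedTrace, Matrix.mul_apply, map_sum, ← Finset.sum_sub_distrib]
  simp only [hτ.sum _ _ fun j _ => h1 _ j, hτ.sum _ _ fun j _ => h2 _ j]
  rw [Finset.sum_comm]
  exact Finset.sum_congr rfl fun j _ => Finset.sum_congr rfl fun i _ =>
    hτ.comm_scalarPlus (hu i j) (hv j i)

/-- The equivalence is only given over `D`, where `τ` has no cyclicity; density and inverse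
closedness of `ℂ + I` move it into `ℂ + I`, where the reduced trace is cyclic. -/
theorem IsTraceOn.reducedTrace_eq (hτ : IsTraceOn I τ) [CompleteSpace D] (hI : ∀ x ∈ I, χ x = 0)
    (hd : ∀ d, d - algebraMap ℂ D (χ d) ∈ closure (I : Set D))
    {m n : Type*} [Fintype m] [Fintype n] {p : Matrix m m D} {q : Matrix n n D}
    (hp : IsIdempotentElem p) (hq : IsIdempotentElem q) (hpS : ∀ i j, p i j ∈ scalarPlus χ I)
    (hqS : ∀ i j, q i j ∈ scalarPlus χ I) (h : MvN p q) :
    reducedTrace χ τ p = reducedTrace χ τ q := by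
  classical
  obtain ⟨u, v, hu, hv, rfl, rfl⟩ := exists_mvN_witness_mem (scalarPlus χ I)
    (dense_scalarPlus hI hd) scalarPlus_inv_mem hp hq hpS hqS h
  exact hτ.reducedTrace_mul_comm hu hv

theorem reducedTrace_blockSum {m n : Type*} [Fintype m] [Fintype n] (p : Matrix m m D)
    (q : Matrix n n D) :
    reducedTrace χ τ (blockSum p q) = reducedTrace χ τ p + reducedTrace χ τ q := by
  simp [reducedTrace, blockSum]

/-- The homomorphism `K₀(R) → K₀(D) → ℂ` given by the reduced trace of a representative
over `ℂ + I`. -/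
theorem IsTraceOn.exists_K0_hom (hτ : IsTraceOn I τ) [CompleteSpace D] (hI : ∀ x ∈ I, χ x = 0)
    (J : Ideal D) [J.IsTwoSided] (hJI : J ≤ I)
    (hd : ∀ d, d - algebraMap ℂ D (χ d) ∈ closure (J : Set D))
    (hint : ∀ (n : ℕ) (e : Matrix (Fin n) (Fin n) D), IsIdempotentElem e →
      (∀ i j, e i j ∈ scalarPlus χ J) → ∃ k : ℤ, reducedTrace χ τ e = k)
    {R : Type*} [Ring R] (φ : R →+* D) :
    ∃ f : K0 R →+ ℂ, (∀ x, ∃ k : ℤ, f x = k) ∧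
      ∀ (n : ℕ) (p : Matrix (Fin n) (Fin n) R) (hp : IsIdempotentElem p),
        (∀ i j, φ (p i j) ∈ scalarPlus χ I) → f (K0.mk p hp) = reducedTrace χ τ (p.map φ) := by
  have hdI : ∀ d, d - algebraMap ℂ D (χ d) ∈ closure (I : Set D) := fun d =>
    closure_mono hJI (hd d)
  -- Representatives are taken over the smaller ring `ℂ + J`, where integrality is known, but
  -- compared over `ℂ + I`, so that the formula also holds for idempotents with entries in `ℂ + I`.
  choose e he heS hpe using fun p : IdemMatrix R =>
    exists_mvN_scalarPlus hd (fun x hx => hI x (hJI hx)) (isIdempotentElem_map φ p.idem)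
  have heI : ∀ p i j, e p i j ∈ scalarPlus χ I := fun p i j => scalarPlus_mono hJI (heS p i j)
  let g : IdemMatrix R → ℂ := fun p => reducedTrace χ τ (e p)
  have hmap := fun p : IdemMatrix R => isIdempotentElem_map φ p.idem
  have hg : ∀ p q : IdemMatrix R, MvN p.mat q.mat → g p = g q := fun p q h =>
    hτ.reducedTrace_eq hI hdI (he p) (he q) (heI p) (heI q)
      ((hpe p).symm.trans (he p) (he q) ((h.map φ).trans (hmap p) (he q) (hpe q)))
  have hadd : ∀ p q : IdemMatrix R, g (p.sum q) = g p + g q := fun p q => by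
    have hb := isIdempotentElem_blockSum (he p) (he q)
    rw [← reducedTrace_blockSum]
    refine hτ.reducedTrace_eq hI hdI (he _) hb (heI _) ?_ ?_
    · rintro (i | i) (j | j)
      exacts [heI p i j, (scalarPlus χ I).zero_mem, (scalarPlus χ I).zero_mem, heI q i j]
    · have h1 := (p.sum_mvN q).map φ
      have h2 : (blockSum p.mat q.mat).map φ = blockSum (p.mat.map φ) (q.mat.map φ) := by
        simp [blockSum, Matrix.fromBlocks_map, Matrix.map_zero]
      rw [h2] at h1
      exact (hpe (p.sum q)).symm.trans (he _) hb
        (h1.trans (hmap _) hb ((hpe p).blockSum (hpe q)))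
  refine ⟨K0.lift g hg hadd, fun x => ?_, fun n p hp hpS => ?_⟩
  · have := K0.lift_mem g hg hadd (Int.castAddHom ℂ).range (fun p => by
      obtain ⟨k, hk⟩ := hint _ (e p) (he p) (heS p)
      exact ⟨k, hk.symm⟩) x
    obtain ⟨k, hk⟩ := this
    exact ⟨k, hk.symm⟩
  · rw [K0.lift_mk]
    exact hτ.reducedTrace_eq hI hdI (he _) (isIdempotentElem_map φ hp) (heI _) hpS
      (hpe ⟨n, p, hp⟩).symm

end ScalarPlusIdeal

/-! ### Extension of representations to the enveloping C*-algebra -/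

section EnvelopeExtension

variable {R : Type*} [Ring R] [Algebra ℂ R] [StarRing R]
  {T : Type*} [NormedRing T] [StarRing T] [CStarRing T] [NormedAlgebra ℂ T]

theorem isCStarSeminorm_norm_comp (ψ : R →⋆ₐ[ℂ] T) :
    IsCStarSeminorm ((normSeminorm ℂ T).comp (ψ : R →ₐ[ℂ] T).toLinearMap) where
  mul_le a b := by
    simpa using norm_mul_le (ψ a) (ψ b)
  star_mul_self a := by
    simpa [sq, map_star] using CStarRing.norm_star_mul_self (x := ψ a)

theorem IsCStarEnvelope.norm_le {B : Type*} [CStarAlgebra B] {ι : R →⋆ₐ[ℂ] B}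
    (hι : IsCStarEnvelope ι) (ψ : R →⋆ₐ[ℂ] T) (a : R) : ‖ψ a‖ ≤ ‖ι a‖ :=
  hι.le_norm _ (isCStarSeminorm_norm_comp ψ) a

/-- A *-representation extends to the C*-enveloping algebra. -/
theorem IsCStarEnvelope.exists_extension [CompleteSpace T] {B : Type*} [CStarAlgebra B]
    {ι : R →⋆ₐ[ℂ] B} (hι : IsCStarEnvelope ι) (ψ : R →⋆ₐ[ℂ] T) :
    ∃ Ψ : B →+* T, Continuous Ψ ∧ ∀ a, Ψ (ι a) = ψ a := by
  let e : R →ₗ[ℂ] B := (ι : R →ₐ[ℂ] B).toLinearMap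
  let f : R →ₗ[ℂ] T := (ψ : R →ₐ[ℂ] T).toLinearMap
  have he : DenseRange e := hι.dense
  have hext : ∀ a, f.extendOfNorm e (ι a) = ψ a := fun a =>
    LinearMap.extendOfNorm_eq he ⟨1, fun x => by rw [one_mul]; exact hι.norm_le ψ x⟩ a
  let F := f.extendOfNorm e
  refine ⟨
    { toFun := F
      map_one' := by
        have := hext 1
        rwa [map_one ι, map_one ψ] at this
      map_mul' := fun a b => ?_
      map_zero' := map_zero F
      map_add' := map_add F }, F.continuous, hext⟩
  refine DenseRange.induction_on₂ (p := fun a b => F (a * b) = F a * F b) hι.dense ?_ ?_ a b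
  · exact isClosed_eq (by fun_prop) (by fun_prop)
  · intro x y
    rw [← map_mul]
    change f.extendOfNorm e (ι (x * y)) = f.extendOfNorm e (ι x) * f.extendOfNorm e (ι y)
    rw [hext, hext, hext, map_mul]

end EnvelopeExtension

/-! ### Compact perturbations of scalars -/

section ScalarPlusCompact

open Filter Topology

variable {H : Type*} [NormedAddCommGroup H] [InnerProductSpace ℂ H] [CompleteSpace H]

theorem mul_left_mem_closure_finiteRankSpan (S : H →L[ℂ] H) {T : H →L[ℂ] H}
    (h : T ∈ (finiteRankSpan H).topologicalClosure) :
    S * T ∈ (finiteRankSpan H).topologicalClosure :=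
  map_mem_closure (continuous_const.mul continuous_id) h fun _ hx =>
    mul_left_mem_finiteRankSpan S hx

theorem mul_right_mem_closure_finiteRankSpan (S : H →L[ℂ] H) {T : H →L[ℂ] H}
    (h : T ∈ (finiteRankSpan H).topologicalClosure) :
    T * S ∈ (finiteRankSpan H).topologicalClosure :=
  map_mem_closure (f := fun x => x * S) (continuous_id.mul continuous_const) h fun _ hx =>
    mul_right_mem_finiteRankSpan S hx

variable (H) in
/-- The pairs `(T, c)` of an operator and a scalar such that `T - c` is compact (i.e. a norm limit
of finite rank operators). -/
def scalarPlusCompact : Subalgebra ℂ ((H →L[ℂ] H) × ℂ) where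
  carrier := {d | d.1 - d.2 • (1 : H →L[ℂ] H) ∈ (finiteRankSpan H).topologicalClosure}
  mul_mem' := by
    intro a b ha hb
    have h : (a * b).1 - (a * b).2 • (1 : H →L[ℂ] H)
        = a.1 * (b.1 - b.2 • 1) + (a.1 - a.2 • 1) * (b.2 • 1) := by
      simp only [Prod.fst_mul, Prod.snd_mul, mul_sub, mul_smul_comm, mul_one, smul_smul,
        smul_sub, mul_comm a.2]
      abel
    rw [Set.mem_ofPred_eq, h]
    exact add_mem (mul_left_mem_closure_finiteRankSpan _ hb)
      (mul_right_mem_closure_finiteRankSpan _ ha)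
  add_mem' := by
    intro a b ha hb
    have h : (a + b).1 - (a + b).2 • (1 : H →L[ℂ] H) = (a.1 - a.2 • 1) + (b.1 - b.2 • 1) := by
      simp only [Prod.fst_add, Prod.snd_add, add_smul]
      abel
    rw [Set.mem_ofPred_eq, h]
    exact add_mem ha hb
  algebraMap_mem' c := by
    simp [Algebra.algebraMap_eq_smul_one]

theorem mem_scalarPlusCompact {d : (H →L[ℂ] H) × ℂ} : d ∈ scalarPlusCompact H ↔
    d.1 - d.2 • (1 : H →L[ℂ] H) ∈ (finiteRankSpan H).topologicalClosure := Iff.rfl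

theorem isClosed_scalarPlusCompact :
    IsClosed (scalarPlusCompact H : Set ((H →L[ℂ] H) × ℂ)) :=
  (Submodule.isClosed_topologicalClosure (finiteRankSpan H)).preimage
    (f := fun d : (H →L[ℂ] H) × ℂ => d.1 - d.2 • (1 : H →L[ℂ] H)) (by fun_prop)

instance : CompleteSpace (scalarPlusCompact H) :=
  (isClosed_scalarPlusCompact (H := H)).completeSpace_coe

variable (H) in
/-- The character of `ℂ + 𝒦` with kernel `𝒦`. -/
def scalarPart : scalarPlusCompact H →ₐ[ℂ] ℂ :=
  (AlgHom.snd ℂ (H →L[ℂ] H) ℂ).comp (scalarPlusCompact H).val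

theorem coe_sub_scalarPart (d : scalarPlusCompact H) :
    ((d - algebraMap ℂ _ (scalarPart H d) : scalarPlusCompact H) : (H →L[ℂ] H) × ℂ)
      = (d.1.1 - d.1.2 • 1, 0) := by
  refine Prod.ext ?_ ?_
  · simp [scalarPart, Algebra.algebraMap_eq_smul_one]
  · simp [scalarPart, Algebra.algebraMap_eq_smul_one]

variable (H) in
/-- The trace class operators, as an ideal of `ℂ + 𝒦`. -/
def traceClassIdeal : Ideal (scalarPlusCompact H) where
  carrier := {d | d.1.2 = 0 ∧ IsTraceClass d.1.1}
  add_mem' := fun ha hb => ⟨by simp [ha.1, hb.1], ha.2.add hb.2⟩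
  zero_mem' := ⟨rfl, isTraceClass_zero⟩
  smul_mem' := fun c _ hd => ⟨by simp [hd.1], hd.2.mul_left c.1.1⟩

instance : (traceClassIdeal H).IsTwoSided :=
  ⟨fun {_} c hd => ⟨by simp [hd.1], hd.2.mul_right c.1.1⟩⟩

variable (H) in
/-- The finite rank operators, as an ideal of `ℂ + 𝒦`. -/
def finiteRankIdeal : Ideal (scalarPlusCompact H) where
  carrier := {d | d.1.2 = 0 ∧ d.1.1 ∈ finiteRankSpan H}
  add_mem' := fun ha hb => ⟨by simp [ha.1, hb.1], add_mem ha.2 hb.2⟩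
  zero_mem' := ⟨rfl, zero_mem _⟩
  smul_mem' := fun c _ hd => ⟨by simp [hd.1], mul_left_mem_finiteRankSpan c.1.1 hd.2⟩

instance : (finiteRankIdeal H).IsTwoSided :=
  ⟨fun {_} c hd => ⟨by simp [hd.1], mul_right_mem_finiteRankSpan c.1.1 hd.2⟩⟩

theorem mem_scalarPlus_traceClassIdeal {d : scalarPlusCompact H} :
    d ∈ scalarPlus (scalarPart H) (traceClassIdeal H) ↔ IsTraceClass (d.1.1 - d.1.2 • 1) := by
  rw [mem_scalarPlus]
  change _ ∧ _ ↔ _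
  rw [coe_sub_scalarPart]
  simp

theorem mem_scalarPlus_finiteRankIdeal {d : scalarPlusCompact H} :
    d ∈ scalarPlus (scalarPart H) (finiteRankIdeal H) ↔
      d.1.1 - d.1.2 • 1 ∈ finiteRankSpan H := by
  rw [mem_scalarPlus]
  change _ ∧ _ ↔ _
  rw [coe_sub_scalarPart]
  simp

theorem finiteRankIdeal_le : finiteRankIdeal H ≤ traceClassIdeal H :=
  fun _ hd => ⟨hd.1, isTraceClass_of_mem_finiteRankSpan hd.2⟩

/-- Finite rank approximants of the compact part, paired with the scalar 0, already lie in the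
algebra, so density holds in its subspace topology. -/
theorem sub_scalarPart_mem_closure (d : scalarPlusCompact H) :
    d - algebraMap ℂ _ (scalarPart H d) ∈
      closure (finiteRankIdeal H : Set (scalarPlusCompact H)) := by
  obtain ⟨T, hT, hlim⟩ := mem_closure_iff_seq_limit.1 d.2
  have hmem : ∀ k, ((T k, 0) : (H →L[ℂ] H) × ℂ) ∈ scalarPlusCompact H := fun k => by
    rw [mem_scalarPlusCompact]
    simpa using Submodule.le_topologicalClosure _ (hT k)
  refine mem_closure_of_tendsto (b := atTop) (f := fun k => (⟨_, hmem k⟩ : scalarPlusCompact H)) ?_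
    (Eventually.of_forall fun k => ⟨rfl, hT k⟩)
  rw [tendsto_subtype_rng, coe_sub_scalarPart]
  exact hlim.prodMk_nhds tendsto_const_nhds

theorem isTraceOn_traceClassIdeal :
    IsTraceOn (traceClassIdeal H) (fun d => opTrace d.1.1) where
  zero := opTrace_zero
  add _ hx _ hy := opTrace_add hx.2 hy.2
  comm _ hx y := (opTrace_mul_comm hx.2 y.1.1).symm

theorem exists_int_reducedTrace (n : ℕ) (e : Matrix (Fin n) (Fin n) (scalarPlusCompact H))
    (he : IsIdempotentElem e)
    (heS : ∀ i j, e i j ∈ scalarPlus (scalarPart H) (finiteRankIdeal H)) :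
    ∃ k : ℤ, reducedTrace (scalarPart H) (fun d => opTrace d.1.1) e = k := by
  obtain ⟨k, hk⟩ := exists_int_sum_opTrace
    (isIdempotentElem_map ((AlgHom.fst ℂ (H →L[ℂ] H) ℂ).comp (scalarPlusCompact H).val) he)
    (isIdempotentElem_map (scalarPart H) he)
    fun i j => mem_scalarPlus_finiteRankIdeal.1 (heS i j)
  refine ⟨k, hk ▸ Finset.sum_congr rfl fun i _ => ?_⟩
  change opTrace _ = _
  rw [coe_sub_scalarPart]
  rfl

end ScalarPlusCompact

/-! ### The two homomorphisms on `K₀` of the enveloping algebra -/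

section Characters

variable {R : Type*} [Ring R] [Algebra ℂ R] [StarRing R] {C : Type*} [CStarAlgebra C]
  {ι : R →⋆ₐ[ℂ] C}

/-- The extended character sends idempotents over `C` to complex idempotent matrices, whose trace is
their rank. -/
theorem IsCStarEnvelope.exists_K0_hom_character (hι : IsCStarEnvelope ι) (ε : R →⋆ₐ[ℂ] ℂ) :
    ∃ f : K0 C →+ ℂ, (∀ x, ∃ k : ℤ, f x = k) ∧
      ∀ (n : ℕ) (p : Matrix (Fin n) (Fin n) R) (hp : IsIdempotentElem (p.map ι)),
        f (K0.mk (p.map ι) hp) = ε p.trace := by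
  obtain ⟨ε', -, hε'⟩ := hι.exists_extension ε
  let g : IdemMatrix C → ℂ := fun p => (p.mat.map ε').trace
  have htr : ∀ {m n : Type} [Fintype m] [Fintype n] {p : Matrix m m C} {q : Matrix n n C},
      MvN p q → (p.map ε').trace = (q.map ε').trace := by
    intro m n _ _ p q h
    obtain ⟨u, v, huv, hvu⟩ := h.map ε'
    rw [← huv, ← hvu, Matrix.trace_mul_comm]
  refine ⟨K0.lift g (fun p q h => htr h) fun p q => ?_, fun x => ?_, fun n p hp => ?_⟩
  · refine (htr (p.sum_mvN q)).trans ?_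
    simp [g, blockSum, Matrix.fromBlocks_map, Matrix.map_zero, Matrix.trace]
  · obtain ⟨k, hk⟩ := K0.lift_mem g (fun p q h => htr h) _ (Int.castAddHom ℂ).range (fun p => by
      obtain ⟨k, hk⟩ := exists_int_trace_of_isIdempotentElem (isIdempotentElem_map ε' p.idem)
      exact ⟨k, hk.symm⟩) x
    exact ⟨k, hk.symm⟩
  · rw [K0.lift_mk]
    simp [g, Matrix.trace, hε']

/-- The index pairing of `K₀` with a finitely summable Fredholm module `(π, ε)`. -/
theorem IsCStarEnvelope.exists_K0_hom_index (hι : IsCStarEnvelope ι) (ε : R →⋆ₐ[ℂ] ℂ)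
    {H : Type*} [NormedAddCommGroup H] [InnerProductSpace ℂ H] [CompleteSpace H]
    (π : R →⋆ₐ[ℂ] (H →L[ℂ] H)) (hπ : ∀ b, IsTraceClass (π b - ε b • (1 : H →L[ℂ] H))) :
    ∃ f : K0 C →+ ℂ, (∀ x, ∃ k : ℤ, f x = k) ∧
      ∀ (n : ℕ) (p : Matrix (Fin n) (Fin n) R) (hp : IsIdempotentElem (p.map ι)),
        f (K0.mk (p.map ι) hp) = opTrace (π p.trace - ε p.trace • (1 : H →L[ℂ] H)) := by
  obtain ⟨ε', hε'c, hε'⟩ := hι.exists_extension ε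
  obtain ⟨π', hπ'c, hπ'⟩ := hι.exists_extension π
  -- The condition is closed and holds on the dense image of `ι`, trace class operators being norm
  -- limits of finite rank ones. The scalar is carried along through `ε'` because on a
  -- finite-dimensional `H` the operator does not determine it.
  have hmem : ∀ c, (π'.prod ε') c ∈ (scalarPlusCompact H).toSubring := fun c => by
    refine hι.dense.induction_on (p := fun c => (π'.prod ε') c ∈ scalarPlusCompact H) c ?_ ?_
    · exact isClosed_scalarPlusCompact.preimage (hπ'c.prodMk hε'c)
    · intro b
      rw [mem_scalarPlusCompact]
      simpa [hε', hπ'] using (hπ b).mem_closure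
  let φ : C →+* scalarPlusCompact H := (π'.prod ε').codRestrict (scalarPlusCompact H).toSubring hmem
  obtain ⟨f, hfint, hf⟩ := isTraceOn_traceClassIdeal.exists_K0_hom (χ := scalarPart H)
    (fun x hx => hx.1) (finiteRankIdeal H) finiteRankIdeal_le sub_scalarPart_mem_closure
    exists_int_reducedTrace φ
  refine ⟨f, hfint, fun n p hp => ?_⟩
  have hφ : ∀ b, (φ (ι b)).1 = (π b, ε b) := fun b => Prod.ext (hπ' b) (hε' b)
  rw [hf n _ hp fun i j => by
    rw [Matrix.map_apply, mem_scalarPlus_traceClassIdeal, hφ]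
    exact hπ _]
  have h1 : π p.trace - ε p.trace • (1 : H →L[ℂ] H)
      = ∑ i, (π (p i i) - ε (p i i) • (1 : H →L[ℂ] H)) := by
    simp [Matrix.trace, map_sum, Finset.sum_smul]
  rw [h1, (opTrace_sum _ _ fun i _ => hπ _).2]
  refine Finset.sum_congr rfl fun i _ => ?_
  change opTrace _ = _
  rw [coe_sub_scalarPart, Matrix.map_apply, Matrix.map_apply, hφ]

end Characters

/-! ### Dual bases and their idempotents -/

section DualBasis

variable {R : Type*} [Ring R] {E : Type*} [AddCommGroup E] [Module Rᵐᵒᵖ E]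

/-- `(ξ, ψ)` is a dual basis of the right module `E`. -/
def IsDualBasis {κ : Type*} [Fintype κ] (ξ : κ → E) (ψ : κ → (E →ₗ[Rᵐᵒᵖ] R)) : Prop :=
  ∀ e, ∑ i, op (ψ i e) • ξ i = e

/-- The idempotent matrix `ψᵢ(ξⱼ)` of a dual basis. -/
def gram {κ : Type*} (ξ : κ → E) (ψ : κ → (E →ₗ[Rᵐᵒᵖ] R)) : Matrix κ κ R := fun i j => ψ i (ξ j)

theorem IsDualBasis.sum_mul {κ : Type*} [Fintype κ] {ξ : κ → E} {ψ : κ → (E →ₗ[Rᵐᵒᵖ] R)}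
    (h : IsDualBasis ξ ψ) (φ : E →ₗ[Rᵐᵒᵖ] R) (e : E) : ∑ j, φ (ξ j) * ψ j e = φ e := by
  conv_rhs => rw [← h e, map_sum]
  simp

theorem IsDualBasis.isIdempotentElem_gram {κ : Type*} [Fintype κ] {ξ : κ → E}
    {ψ : κ → (E →ₗ[Rᵐᵒᵖ] R)} (h : IsDualBasis ξ ψ) : IsIdempotentElem (gram ξ ψ) := by
  ext i j
  rw [Matrix.mul_apply]
  exact h.sum_mul (ψ i) (ξ j)

/-- The mixed matrices `ψᵢ(ξ'ⱼ)` and `ψ'ⱼ(ξᵢ)` implement the equivalence. -/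
theorem IsDualBasis.mvN_gram {κ κ' : Type*} [Fintype κ] [Fintype κ'] {ξ : κ → E}
    {ψ : κ → (E →ₗ[Rᵐᵒᵖ] R)} {ξ' : κ' → E} {ψ' : κ' → (E →ₗ[Rᵐᵒᵖ] R)} (h : IsDualBasis ξ ψ)
    (h' : IsDualBasis ξ' ψ') : MvN (gram ξ ψ) (gram ξ' ψ') := by
  refine ⟨Matrix.of fun i j => ψ i (ξ' j), Matrix.of fun j i => ψ' j (ξ i), ?_, ?_⟩
  · ext i j
    rw [Matrix.mul_apply]
    exact h'.sum_mul (ψ i) (ξ j)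
  · ext i j
    rw [Matrix.mul_apply]
    exact h.sum_mul (ψ' i) (ξ' j)

/-- The columns of `p`, with the coordinate functions, form a dual basis of its range because `p`
fixes that range. -/
theorem IsPresentedBy.exists_dualBasis {N : ℕ} {p : Matrix (Fin N) (Fin N) R}
    (h : IsPresentedBy E p) : ∃ (ξ : Fin N → E) (ψ : Fin N → (E →ₗ[Rᵐᵒᵖ] R)),
      IsDualBasis ξ ψ ∧ gram ξ ψ = p := by
  obtain ⟨hp, ⟨Φ⟩⟩ := h
  have hΦ : ∀ e, p.mulVec (Φ e).1 = (Φ e).1 := fun e => by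
    obtain ⟨x, hx⟩ := (Φ e).2
    rw [← hx]
    change p.mulVec (p.mulVec x) = p.mulVec x
    rw [Matrix.mulVec_mulVec, show p * p = p from hp]
  let c : Fin N → LinearMap.range (mulVecRight p) := fun j =>
    ⟨p.mulVec (Pi.single j 1), ⟨_, rfl⟩⟩
  refine ⟨fun j => Φ.symm (c j), fun i =>
    { toFun := fun e => (Φ e).1 i
      map_add' := fun x y => by simp
      map_smul' := fun b x => by simp }, fun e => ?_, ?_⟩
  · apply Φ.injective
    rw [map_sum]
    simp only [map_smul, LinearEquiv.apply_symm_apply]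
    apply Subtype.ext
    rw [← hΦ e]
    ext i
    simp [c, Matrix.mulVec, dotProduct]
  · ext i j
    simp [gram, c]

theorem K0.mk_eq {N N' : ℕ} {p : Matrix (Fin N) (Fin N) R} {q : Matrix (Fin N') (Fin N') R}
    (hp : IsIdempotentElem p) (hq : IsIdempotentElem q) (h : MvN p q) :
    K0.mk p hp = K0.mk q hq :=
  congrArg (fun x : VMonoid R => Algebra.GrothendieckAddGroup.of x) (Quotient.sound h)

/-- Frees the class from the chosen presenting idempotent; for `E ⊗ E` this allows the product dual
basis. -/
theorem moduleClass_eq {S F : Type*} [Ring S] [FunLike F R S] [RingHomClass F R S] (f : F)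
    [Module.Finite Rᵐᵒᵖ E] [Module.Projective Rᵐᵒᵖ E] {N : ℕ} {ξ : Fin N → E}
    {ψ : Fin N → (E →ₗ[Rᵐᵒᵖ] R)} (h : IsDualBasis ξ ψ) :
    moduleClass E f = K0.mk ((gram ξ ψ).map f)
      (isIdempotentElem_map f h.isIdempotentElem_gram) := by
  obtain ⟨ξ', ψ', h', hp⟩ := (presentingIdem_spec R E).exists_dualBasis
  refine K0.mk_eq _ _ (MvN.map f ?_)
  rw [← hp]
  exact h'.mvN_gram h

theorem IsDualBasis.reindex {κ κ' : Type*} [Fintype κ] [Fintype κ'] {ξ : κ → E}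
    {ψ : κ → (E →ₗ[Rᵐᵒᵖ] R)} (h : IsDualBasis ξ ψ) (e : κ' ≃ κ) :
    IsDualBasis (ξ ∘ e) (ψ ∘ e) := fun x => by
  exact (e.sum_comp fun i => op (ψ i x) • ξ i).trans (h x)

end DualBasis

/-! ### Dual bases of tensor products -/

section TensorDualBasis

variable {R : Type*} [Ring R] {E : Type*} [AddCommGroup E] [Module Rᵐᵒᵖ E]
  {F : Type*} [AddCommGroup F] [Module R F]

theorem BTensor.tmul_sum {κ : Type*} (s : Finset κ) (e : E) (g : κ → F) :
    BTensor.tmul R e (∑ k ∈ s, g k) = ∑ k ∈ s, BTensor.tmul R e (g k) :=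
  map_sum (AddMonoidHom.mk' (BTensor.tmul R e) (BTensor.tmul_add e)) g _

theorem BTensor.sum_tmul {κ : Type*} (s : Finset κ) (g : κ → E) (f : F) :
    BTensor.tmul R (∑ k ∈ s, g k) f = ∑ k ∈ s, BTensor.tmul R (g k) f :=
  map_sum (AddMonoidHom.mk' (fun e => BTensor.tmul R e f) fun e e' => BTensor.add_tmul e e' f) g _

theorem IsDualBasis.sum_tmul {κ : Type*} [Fintype κ] {ξ : κ → E} {ψ : κ → (E →ₗ[Rᵐᵒᵖ] R)}
    (h : IsDualBasis ξ ψ) (e : E) (f : F) :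
    ∑ j, BTensor.tmul R (ξ j) (ψ j e • f) = BTensor.tmul R e f := by
  conv_rhs => rw [← h e, BTensor.sum_tmul]
  exact Finset.sum_congr rfl fun j _ => (BTensor.smul_tmul _ _ _).symm

theorem exists_tensor_functional [Module Rᵐᵒᵖ F] [SMulCommClass R Rᵐᵒᵖ F]
    (φ : E →ₗ[Rᵐᵒᵖ] R) (φ' : F →ₗ[Rᵐᵒᵖ] R) :
    ∃ Ψ : BTensor R E F →ₗ[Rᵐᵒᵖ] R, ∀ e f, Ψ (BTensor.tmul R e f) = φ' (φ e • f) := by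
  let Θ : BTensor R E F →+ R := BTensor.lift
    (AddMonoidHom.mk' (fun e => AddMonoidHom.mk' (fun f => φ' (φ e • f))
      (fun f f' => by rw [smul_add, map_add]))
      (fun e e' => by ext f; simp [add_smul]))
    (fun e b f => by
      change φ' (φ (op b • e) • f) = φ' (φ e • b • f)
      simp [mul_smul])
  have hΘ : ∀ e f, Θ (BTensor.tmul R e f) = φ' (φ e • f) := fun _ _ => rfl
  refine ⟨
    { toFun := Θ
      map_add' := map_add Θ
      map_smul' := fun s x => ?_ }, hΘ⟩
  induction x using BTensor.induction with
  | zero => simp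
  | tmul e f =>
    rw [BTensor.op_smul_tmul, hΘ, hΘ, smul_comm, map_smul]
    rfl
  | add x y hx hy => rw [smul_add, map_add, hx, hy, map_add, smul_add]

theorem IsDualBasis.exists_tensor [Module Rᵐᵒᵖ F] [SMulCommClass R Rᵐᵒᵖ F] {κ κ' : Type*}
    [Fintype κ] [Fintype κ'] {ξ : κ → E} {ψ : κ → (E →ₗ[Rᵐᵒᵖ] R)} {ξ' : κ' → F}
    {ψ' : κ' → (F →ₗ[Rᵐᵒᵖ] R)} (h : IsDualBasis ξ ψ) (h' : IsDualBasis ξ' ψ') :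
    ∃ Ψ : κ × κ' → (BTensor R E F →ₗ[Rᵐᵒᵖ] R),
      IsDualBasis (fun jk : κ × κ' => BTensor.tmul R (ξ jk.1) (ξ' jk.2)) Ψ ∧
      ∀ jk e f, Ψ jk (BTensor.tmul R e f) = ψ' jk.2 (ψ jk.1 e • f) := by
  choose Ψ hΨ using fun jk : κ × κ' => exists_tensor_functional (ψ jk.1) (ψ' jk.2)
  refine ⟨Ψ, fun x => ?_, hΨ⟩
  induction x using BTensor.induction with
  | zero => simp
  | tmul e f =>
    rw [Fintype.sum_prod_type]
    refine Eq.trans (Finset.sum_congr rfl fun j _ => ?_) (h.sum_tmul e f)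
    conv_rhs => rw [← h' (ψ j e • f), BTensor.tmul_sum]
    refine Finset.sum_congr rfl fun k _ => ?_
    rw [hΨ, BTensor.op_smul_tmul]
  | add x y hx hy =>
    conv_rhs => rw [← hx, ← hy]
    rw [← Finset.sum_add_distrib]
    refine Finset.sum_congr rfl fun jk _ => ?_
    rw [map_add, MulOpposite.op_add, add_smul]

end TensorDualBasis

/-! ### Trivializations as matrices over `A` -/

section Trivialization

variable {A : Type*} [Ring A] [StarRing A] [Algebra ℂ A] [StarModule ℂ A]
  {B : StarSubalgebra ℂ A} {E : Type*} [AddCommGroup E] [Module Bᵐᵒᵖ E]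

theorem exists_extended_functional (φ : E →ₗ[Bᵐᵒᵖ] B) :
    ∃ Θ : BTensor B E A →+ A, (∀ e a, Θ (BTensor.tmul B e a) = φ e * a) ∧
      ∀ a x, Θ (op a • x) = Θ x * a := by
  let Θ : BTensor B E A →+ A := BTensor.lift
    (AddMonoidHom.mk' (fun e => AddMonoidHom.mk' (fun a => (φ e : A) * a)
      (fun a a' => mul_add _ _ _))
      (fun e e' => by ext a; simp [add_mul]))
    (fun e b a => by
      change (φ (op b • e) : A) * a = φ e * ((b : A) * a)
      simp [mul_assoc])
  refine ⟨Θ, fun _ _ => rfl, fun a x => ?_⟩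
  induction x using BTensor.induction with
  | zero => simp
  | tmul e a' =>
    rw [BTensor.op_smul_tmul]
    change (φ e : A) * (a' * a) = φ e * a' * a
    rw [mul_assoc]
  | add x y hx hy => rw [smul_add, map_add, hx, hy, map_add, add_mul]

/-- A trivialization over `A` conjugates the left multiplication by `b` on `E` to the scalar
matrix `b`, over `A`. -/
theorem TrivializesOver.exists_matrices [Module B E] [SMulCommClass B Bᵐᵒᵖ E]
    (hE : TrivializesOver B E) {κ : Type*} [Fintype κ] {ξ : κ → E} {ψ : κ → (E →ₗ[Bᵐᵒᵖ] B)} (h : IsDualBasis ξ ψ) :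
    ∃ (r : ℕ) (U : κ → Fin r → A) (V : Fin r → κ → A),
      (∀ (b : B) i k, (ψ i (b • ξ k) : A) = ∑ s, U i s * b * V s k) ∧
      ∀ s t, ∑ i, V s i * U i t = if s = t then 1 else 0 := by
  obtain ⟨r, Φ, hΦ⟩ := hE
  choose Θ hΘ hΘ' using fun i => exists_extended_functional (A := A) (ψ i)
  let g : Fin r → BTensor B E A := fun s => Φ.symm (Pi.single s 1)
  have hg : ∀ x, ∑ s, op (Φ x s) • g s = x := fun x => by
    apply Φ.injective
    rw [map_sum]
    simp only [map_smul, g, LinearEquiv.apply_symm_apply]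
    ext s
    simp [Finset.sum_apply, Pi.single_apply]
  have hξ : ∀ x, ∑ i, BTensor.tmul B (ξ i) (Θ i x) = x := fun x => by
    induction x using BTensor.induction with
    | zero =>
      refine Finset.sum_eq_zero fun i _ => ?_
      rw [map_zero]
      exact map_zero (AddMonoidHom.mk' (BTensor.tmul B (ξ i)) (BTensor.tmul_add (F := A) (ξ i)))
    | tmul e a =>
      refine Eq.trans (Finset.sum_congr rfl fun i _ => ?_) (h.sum_tmul e a)
      rw [hΘ]
      rfl
    | add x y hx hy =>
      conv_rhs => rw [← hx, ← hy]
      rw [← Finset.sum_add_distrib]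
      exact Finset.sum_congr rfl fun i _ => by rw [map_add, BTensor.tmul_add]
  -- `U` and `V` are the matrices of `Φ⁻¹` and `Φ` between the frame `g` and the generators `ξᵢ ⊗
  -- 1`. The first claim uses left `B`-linearity of `Φ`, the second that `Φ` undoes `Φ⁻¹`.
  refine ⟨r, fun i s => Θ i (g s), fun s i => Φ (BTensor.tmul B (ξ i) 1) s, fun b i k => ?_,
    fun s t => ?_⟩
  · calc (ψ i (b • ξ k) : A) = Θ i (BTensor.tmul B (b • ξ k) 1) := by rw [hΘ, mul_one]
      _ = ∑ s, Θ i (g s) * Φ (BTensor.tmul B (b • ξ k) 1) s := by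
        conv_lhs => rw [← hg (BTensor.tmul B (b • ξ k) 1), map_sum]
        exact Finset.sum_congr rfl fun s _ => hΘ' _ _ _
      _ = _ := by
        refine Finset.sum_congr rfl fun s _ => ?_
        rw [hΦ, mul_assoc]
        rfl
  · have h1 : ∀ i, Φ (BTensor.tmul B (ξ i) 1) s * Θ i (g t)
        = Φ (BTensor.tmul B (ξ i) (Θ i (g t))) s := fun i => by
      have h2 : BTensor.tmul B (ξ i) (Θ i (g t))
          = op (Θ i (g t)) • BTensor.tmul B (ξ i) (1 : A) := by
        rw [BTensor.op_smul_tmul]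
        simp
      rw [h2, map_smul]
      rfl
    simp only [h1]
    rw [← Finset.sum_apply, ← map_sum, hξ]
    simp [g, Pi.single_apply]

end Trivialization

/-! ### Characteristic numbers of `E` and `E ⊗ E` -/

section CharacteristicNumbers

variable {A : Type*} [Ring A] [StarRing A] [Algebra ℂ A] [StarModule ℂ A]
  {B : StarSubalgebra ℂ A} {E : Type*} [AddCommGroup E] [Module B E] [Module Bᵐᵒᵖ E]
  [SMulCommClass B Bᵐᵒᵖ E]

/-- The traces of the idempotents of `E` and `E ⊗ E`, for a dual basis of `E`, in terms of
matrices over `A` that are inverse to each other on one side. -/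
theorem TrivializesOver.exists_trace_eq (hE : TrivializesOver B E) {κ : Type*} [Fintype κ]
    {ξ : κ → E} {ψ : κ → (E →ₗ[Bᵐᵒᵖ] B)} (h : IsDualBasis ξ ψ) :
    ∃ (r : ℕ) (U : κ → Fin r → A) (V : Fin r → κ → A),
      ((gram ξ ψ).trace : A) = ∑ k, ∑ s, U k s * V s k ∧
      ((∑ k, ψ k ((gram ξ ψ).trace • ξ k) : B) : A)
        = ∑ k, ∑ s, U k s * (gram ξ ψ).trace * V s k ∧
      ∀ s, ∑ k, V s k * U k s = 1 := by
  obtain ⟨r, U, V, h1, h2⟩ := hE.exists_matrices h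
  refine ⟨r, U, V, ?_, ?_, fun s => by simpa using h2 s s⟩
  · rw [Matrix.trace, AddSubmonoidClass.coe_finsetSum]
    refine Finset.sum_congr rfl fun k _ => ?_
    simpa [gram] using h1 1 k k
  · rw [AddSubmonoidClass.coe_finsetSum]
    exact Finset.sum_congr rfl fun k _ => h1 _ k k

/-- After applying `ε` everything commutes, so each diagonal entry of `V U` contributes one copy of
`ε b`. -/
theorem trace_character {A : Type*} [Ring A] [StarRing A] [Algebra ℂ A] (ε : A →⋆ₐ[ℂ] ℂ)
    {κ : Type*} [Fintype κ] {r : ℕ} {U : κ → Fin r → A} {V : Fin r → κ → A}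
    (hVU : ∀ s, ∑ k, V s k * U k s = 1) (b : A) :
    ε (∑ k, ∑ s, U k s * b * V s k) = r * ε b := by
  have h : ∀ s, ∑ k, ε (V s k) * ε (U k s) = 1 := fun s => by
    simpa using congrArg ε (hVU s)
  simp only [map_sum, map_mul]
  rw [Finset.sum_comm]
  calc ∑ s, ∑ k, ε (U k s) * ε b * ε (V s k) = ∑ s : Fin r, ε b := by
        refine Finset.sum_congr rfl fun s _ => ?_
        conv_rhs => rw [← one_mul (ε b), ← h s, Finset.sum_mul]
        exact Finset.sum_congr rfl fun k _ => by ring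
    _ = r * ε b := by simp

/-- Cyclicity moves `π(U)` behind `π(V)`, which is legitimate since `X` is trace class even though
the entries of `U` and `V` lie only in `A`; then the diagonal of `V U` is 1. -/
theorem opTrace_conj {A : Type*} [Ring A] [StarRing A] [Algebra ℂ A]
    {H : Type*} [NormedAddCommGroup H] [InnerProductSpace ℂ H] [CompleteSpace H]
    (π : A →⋆ₐ[ℂ] (H →L[ℂ] H)) {κ : Type*} [Fintype κ] {r : ℕ} {U : κ → Fin r → A}
    {V : Fin r → κ → A} (hVU : ∀ s, ∑ k, V s k * U k s = 1) {X : H →L[ℂ] H}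
    (hX : IsTraceClass X) :
    IsTraceClass (∑ k, ∑ s, π (U k s) * X * π (V s k)) ∧
      opTrace (∑ k, ∑ s, π (U k s) * X * π (V s k)) = r * opTrace X := by
  have h1 : ∀ k s, IsTraceClass (π (U k s) * X * π (V s k)) := fun k s =>
    (hX.mul_left _).mul_right _
  have h2 : ∀ k s, IsTraceClass (X * π (V s k * U k s)) := fun k s => hX.mul_right _
  rw [Finset.sum_comm]
  have h3 := fun s => opTrace_sum Finset.univ _ fun k _ => h1 k s
  have h4 := opTrace_sum Finset.univ _ fun s _ => (h3 s).1
  refine ⟨h4.1, ?_⟩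
  rw [h4.2]
  calc _ = ∑ s : Fin r, opTrace X := by
        refine Finset.sum_congr rfl fun s _ => ?_
        rw [(h3 s).2]
        have h5 : ∀ k, opTrace (π (U k s) * X * π (V s k)) = opTrace (X * π (V s k * U k s)) :=
          fun k => by
            rw [mul_assoc, opTrace_mul_comm (hX.mul_right _), mul_assoc, ← map_mul]
        simp only [h5]
        rw [← (opTrace_sum Finset.univ _ fun k _ => h2 k s).2, ← Finset.mul_sum, ← map_sum, hVU,
          map_one, mul_one]
    _ = r * opTrace X := by simp

/-- `ch₀(E) = r`, `ch₀(E ⊗ E) = r²` and `ch₁(E ⊗ E) = 2 r ch₁(E)`. -/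
theorem TrivializesOver.exists_characteristic_numbers (hE : TrivializesOver B E)
    {H : Type*} [NormedAddCommGroup H] [InnerProductSpace ℂ H] [CompleteSpace H]
    (ε : A →⋆ₐ[ℂ] ℂ) (π : A →⋆ₐ[ℂ] (H →L[ℂ] H))
    (hπ : ∀ b : B, IsTraceClass (π (b : A) - ε (b : A) • (1 : H →L[ℂ] H)))
    {κ : Type*} [Fintype κ] {ξ : κ → E} {ψ : κ → (E →ₗ[Bᵐᵒᵖ] B)} (h : IsDualBasis ξ ψ)
    {t t' : B} (ht : t = (gram ξ ψ).trace) (ht' : t' = ∑ k, ψ k (t • ξ k)) :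
    ∃ r : ℕ, ε t = r ∧ ε t' = r ^ 2 ∧
      opTrace (π (t' : A) - ε (t' : A) • (1 : H →L[ℂ] H))
        = 2 * r * opTrace (π (t : A) - ε (t : A) • (1 : H →L[ℂ] H)) := by
  obtain ⟨r, U, V, h1, h2, h3⟩ := hE.exists_trace_eq h
  rw [← ht] at h1 h2
  rw [← ht'] at h2
  have hεt : ε t = r := by
    have := trace_character ε h3 1
    rw [h1]
    simpa using this
  have hεt' : ε t' = ε t * ε t := by
    rw [h2, trace_character ε h3, hεt]
  refine ⟨r, hεt, by rw [hεt', hεt, sq], ?_⟩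
  have hX := hπ t
  obtain ⟨h4, h5⟩ := opTrace_conj π h3 hX
  set X := π (t : A) - ε (t : A) • (1 : H →L[ℂ] H) with hXdef
  -- Since `∑ U V = t` and `∑ U t V = t'`, the conjugated sum is `π(t') - ε(t) π(t)`; adding `ε(t)
  -- X` gives `π(t') - ε(t)²`.
  have h6 : π (t' : A) - ε (t' : A) • (1 : H →L[ℂ] H)
      = (∑ k, ∑ s, π (U k s) * X * π (V s k)) + ε (t : A) • X := by
    have h7 : ∑ k, ∑ s, π (U k s) * X * π (V s k) = π (t' : A) - ε (t : A) • π (t : A) := by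
      have h8 : ∀ c : ℂ, c • π (t : A) = ∑ k, ∑ s, c • (π (U k s) * π (V s k)) := fun c => by
        rw [h1]
        simp only [map_sum, map_mul, Finset.smul_sum]
      rw [h8, h2]
      simp only [map_sum, map_mul, ← Finset.sum_sub_distrib, hXdef, mul_sub, sub_mul,
        mul_smul_comm, smul_mul_assoc, mul_one]
    rw [h7, hεt', hXdef, smul_sub, smul_smul]
    abel
  rw [h6, opTrace_add h4 (hX.smul _), h5, opTrace_smul hX, hεt]
  ring

end CharacteristicNumbers

/-! ### Groups of rank two -/

section RankTwo

/-- In the coordinates `(g, f)` the pair `x, y` has a triangular integer matrix with determinant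
`±1`, so `(g, f)` is onto `ℤ²`. A surjective endomorphism of the Noetherian module `ℤ²` is
injective. -/
theorem rankTwo_basis {G : Type*} [AddCommGroup G] (e : G ≃+ (Fin 2 → ℤ)) (f g : G →+ ℂ)
    (hf : ∀ x, ∃ k : ℤ, f x = k) (hg : ∀ x, ∃ k : ℤ, g x = k) {x y : G} (hfx : f x = 0)
    (hgx : g x = 1) (hfy : f y = 1 ∨ f y = -1) :
    (∃ b : Module.Basis (Fin 2) ℤ G, ⇑b = ![x, y]) ∧ ∀ z, f z = 0 → g z = 0 → z = 0 := by
  choose f' hf' using hf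
  choose g' hg' using hg
  obtain ⟨m, hm⟩ : ∃ m : ℤ, g y = m := ⟨_, hg' y⟩
  let L : G →ₗ[ℤ] (Fin 2 → ℤ) :=
    { toFun := fun z => ![g' z, f' z]
      map_add' := fun a b => by
        have h1 : g' (a + b) = g' a + g' b := by
          have := map_add g a b
          rw [hg', hg', hg'] at this
          exact_mod_cast this
        have h2 : f' (a + b) = f' a + f' b := by
          have := map_add f a b
          rw [hf', hf', hf'] at this
          exact_mod_cast this
        simp [h1, h2]
      map_smul' := fun c a => by
        have h1 : g' (c • a) = c * g' a := by
          have := map_zsmul g c a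
          rw [hg', hg', zsmul_eq_mul] at this
          exact_mod_cast this
        have h2 : f' (c • a) = c * f' a := by
          have := map_zsmul f c a
          rw [hf', hf', zsmul_eq_mul] at this
          exact_mod_cast this
        simp [h1, h2] }
  have hLx : L x = ![1, 0] := by
    have h1 : g' x = 1 := by exact_mod_cast (hg' x).symm.trans hgx
    have h2 : f' x = 0 := by exact_mod_cast (hf' x).symm.trans hfx
    simp [L, h1, h2]
  have hLy : L y = ![m, f' y] := by
    have h1 : g' y = m := by exact_mod_cast (hg' y).symm.trans hm
    simp [L, h1]
  have hu : f' y * f' y = 1 := by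
    rw [hf'] at hfy
    rcases hfy with h | h
    · have : f' y = 1 := by exact_mod_cast h
      simp [this]
    · have : f' y = -1 := by exact_mod_cast h
      simp [this]
  -- The coefficients solve the triangular system, with `f' y` as its own inverse.
  have hcomb : ∀ c d : ℤ, L ((c - m * f' y * d) • x + (f' y * d) • y) = ![c, d] := fun c d => by
    rw [map_add, map_smul, map_smul, hLx, hLy]
    ext i
    fin_cases i
    · simp
      ring
    · simp
      linear_combination d * hu
  have hsurj : Function.Surjective L := fun v =>
    ⟨_, (hcomb (v 0) (v 1)).trans (by ext i; fin_cases i <;> rfl)⟩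
  have hinj : Function.Injective L := by
    have h := IsNoetherian.injective_of_surjective_endomorphism
      (L ∘ₗ (e.symm.toIntLinearEquiv : (Fin 2 → ℤ) →ₗ[ℤ] G))
      (hsurj.comp e.symm.surjective)
    intro a b hab
    have := @h (e a) (e b) (by simpa using hab)
    exact e.injective this
  have hspan : ∀ z, z = (g' z - m * f' y * f' z) • x + (f' y * f' z) • y := fun z =>
    hinj (hcomb (g' z) (f' z)).symm
  have hli : LinearIndependent ℤ ![x, y] := by
    rw [LinearIndependent.pair_iff]
    intro s t hst
    have h := congrArg L hst
    rw [map_add, map_smul, map_smul, hLx, hLy, map_zero] at h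
    have h0 : s + t * m = 0 := by simpa using congrFun h 0
    have h1 : t * f' y = 0 := by simpa using congrFun h 1
    have ht : t = 0 := by linear_combination f' y * h1 - t * hu
    refine ⟨?_, ht⟩
    rw [ht] at h0
    simpa using h0
  refine ⟨⟨Module.Basis.mk hli fun z _ => ?_, Module.Basis.coe_mk _ _⟩, fun z hz1 hz2 => ?_⟩
  · rw [hspan z]
    refine Submodule.add_mem _ (Submodule.smul_mem _ _ (Submodule.subset_span ⟨0, rfl⟩))
      (Submodule.smul_mem _ _ (Submodule.subset_span ⟨1, rfl⟩))
  · have h1 : f' z = 0 := by exact_mod_cast (hf' z).symm.trans hz1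
    have h2 : g' z = 0 := by exact_mod_cast (hg' z).symm.trans hz2
    rw [hspan z, h1, h2]
    simp

end RankTwo

theorem K0.unit_eq_mk_map {R S F : Type*} [Ring R] [Ring S] [FunLike F R S] [RingHomClass F R S]
    (f : F) (h : IsIdempotentElem ((1 : Matrix (Fin 1) (Fin 1) R).map f)) :
    K0.unit S = K0.mk ((1 : Matrix (Fin 1) (Fin 1) R).map f) h := by
  have : (1 : Matrix (Fin 1) (Fin 1) R).map f = 1 := Matrix.map_one f (map_zero f) (map_one f)
  unfold K0.unit
  congr 1
  exact this.symm

end NCBundle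

/-! ### The main theorem -/

open NCBundle in
theorem proposition3p7
    {A : Type*} [Ring A] [StarRing A] [Algebra ℂ A] [StarModule ℂ A]
    (B : StarSubalgebra ℂ A)
    {C : Type*} [CStarAlgebra C] (ι : B →⋆ₐ[ℂ] C) (hι : IsCStarEnvelope ι)
    {H : Type*} [NormedAddCommGroup H] [InnerProductSpace ℂ H] [CompleteSpace H]
    (ε : A →⋆ₐ[ℂ] ℂ) (π : A →⋆ₐ[ℂ] (H →L[ℂ] H))
    (hπ : ∀ b : B, IsTraceClass (π (b : A) - ε (b : A) • (1 : H →L[ℂ] H)))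
    (hK : Nonempty (K0 C ≃+ (Fin 2 → ℤ)))
    (E : Type*) [AddCommGroup E] [Module B E] [Module Bᵐᵒᵖ E] [SMulCommClass B Bᵐᵒᵖ E]
    [Module.Finite Bᵐᵒᵖ E] [Module.Projective Bᵐᵒᵖ E]
    (hE : TrivializesOver B E)
    (hch : ch1 (B := B) ε π E = 1 ∨ ch1 (B := B) ε π E = -1) :
    (∃ b : Module.Basis (Fin 2) ℤ (K0 C), ⇑b = ![K0.unit C, moduleClass (R := B) E ι]) ∧
    ∃ r : ℤ, ch0 (B := B) ε E = r ∧
      r ^ 2 • K0.unit C - (2 * r) • moduleClass (R := B) E ι +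
        moduleClass (R := B) (BTensor B E E) ι = 0 := by
  obtain ⟨e⟩ := hK
  obtain ⟨g, hgint, hg⟩ := hι.exists_K0_hom_character (ε.comp B.subtype)
  obtain ⟨f, hfint, hf⟩ := hι.exists_K0_hom_index (ε.comp B.subtype) (π.comp B.subtype) hπ
  have hfE : f (moduleClass (R := B) E ι) = ch1 (B := B) ε π E := hf _ _ _
  have hgE : g (moduleClass (R := B) E ι) = ch0 (B := B) ε E := hg _ _ _
  -- The formulas for `f` and `g` cover only idempotents coming from `B`, so the unit is written as
  -- the image of the unit matrix over `B`.
  have hunit := K0.unit_eq_mk_map ι (isIdempotentElem_map ι IsIdempotentElem.one)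
  have hf1 : f (K0.unit C) = 0 := by
    rw [hunit, hf]
    simp
  have hg1 : g (K0.unit C) = 1 := by
    rw [hunit, hg]
    simp
  obtain ⟨hbasis, hinj⟩ := rankTwo_basis e f g hfint hgint hf1 hg1 (hfE ▸ hch)
  refine ⟨hbasis, ?_⟩
  obtain ⟨ξ, ψ, hξ, hgram⟩ := (presentingIdem_spec B E).exists_dualBasis
  obtain ⟨Ψ, hΨ, hΨt⟩ := hξ.exists_tensor hξ
  have hΨ' := hΨ.reindex finProdFinEquiv.symm
  have htr : (gram ((fun jk : _ × _ => BTensor.tmul B (ξ jk.1) (ξ jk.2)) ∘ finProdFinEquiv.symm)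
      (Ψ ∘ finProdFinEquiv.symm)).trace = ∑ k, ψ k ((gram ξ ψ).trace • ξ k) := by
    have h1 : ∀ k, ψ k ((gram ξ ψ).trace • ξ k) = ∑ j, ψ k (ψ j (ξ j) • ξ k) := fun k => by
      rw [Matrix.trace, Finset.sum_smul, map_sum]
      rfl
    simp only [h1]
    rw [Finset.sum_comm, ← Fintype.sum_prod_type']
    refine (finProdFinEquiv.symm.sum_comp
      fun jk => Ψ jk (BTensor.tmul B (ξ jk.1) (ξ jk.2))).trans ?_
    exact Finset.sum_congr rfl fun jk _ => hΨt _ _ _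
  obtain ⟨r, hr, hr', hch'⟩ := hE.exists_characteristic_numbers ε π hπ hξ rfl rfl
  rw [← htr] at hr' hch'
  rw [hgram] at hr hch'
  have hclass := moduleClass_eq ι hΨ'
  have hfEE : f (moduleClass (R := B) (BTensor B E E) ι) = 2 * r * ch1 (B := B) ε π E := by
    rw [hclass, hf]
    exact hch'
  have hgEE : g (moduleClass (R := B) (BTensor B E E) ι) = (r : ℂ) ^ 2 := by
    rw [hclass, hg]
    exact hr'
  have hch0 : ch0 (B := B) ε E = r := hr
  refine ⟨r, by rw [hch0]; simp, hinj _ ?_ ?_⟩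
  · rw [map_add, map_sub, map_zsmul, map_zsmul, hf1, hfE, hfEE]
    simp
  · rw [map_add, map_sub, map_zsmul, map_zsmul, hg1, hgE, hgEE, hch0]
    simp
    ring
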